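/- Conventions: $\widehat f(\xi)=\int_{\mathbb R^n} f(x)e^{-2\pi i\langle x,\xi\rangle}\,dx$ (extended to $L^2(\mathbb R^n)$), $T_yf(x)=f(x-y)$, $D_Af(x)=|\det A|^{1/2}f(Ax)$. For a full rank lattice $\Gamma\subset\mathbb R^n$, $\Gamma^*=\{k\in\mathbb R^n:\langle k,\gamma\rangle\in\mathbb Z \text{ for all }\gamma\in\Gamma\}$. For a finite family $F=(f^1,\dots,f^K)$ in $L^2(\mathbb R^n)$, $E^\Gamma(F)$ is the family $(T_\gamma f^i)_{\gamma\in\Gamma,\,1\le i\le K}$, and $\widehat F$ is the column vector of the $\widehat{f^i}$. Orthonormality of $E^\Gamma(F)$ is understood for this indexed family. Let $A$ be an $n\times n$ matrix with rational entries that is expansive (all its complex eigenvalues $\lambda$ satisfy $|\lambda|>1$). Put $B=A^\top$, $b=|\det A|$, $\Gamma=A\mathbb Z^n+\mathbb Z^n$, $\Lambda=A\mathbb Z^n$, $p=|\Gamma/A\mathbb Z^n|$, $q=|\Gamma/\mathbb Z^n|$. Let $\{d_1,\dots,d_p\}\subset\Gamma$ and $\{k_1,\dots,k_q\}\subset\Gamma$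 be complete sets of representatives of $\Gamma/\Lambda$ and of $\Gamma/\mathbb Z^n$, respectively. Let $V_0$ be a closed subspace of $L^2(\mathbb R^n)$, and suppose that $\Phi=(\varphi^1,\dots,\varphi^N)$ in $V_0$ is such that $E^\Gamma(\Phi)$ is an orthonormal basis of $V_0$. Suppose that $V_0$ is refinable, that is, $V_0\subset V_1:=D_A(V_0)$. Let $\Psi=(\psi^1,\dots,\psi^L)$ be a finite family in $V_1$. Let $\widetilde\Phi=(T_{k_j}\varphi^l)_{1\le j\le q,\,1\le l\le N}$. Let the low-pass filter $M$ ($qN\times N$) and the high-pass filter $H$ ($L\times N$) be measurable $\Gamma^*$-periodic matrix functions on $\mathbb R^n$ with $$b^{1/2}\,\widehat{\widetilde\Phi}(B\xi)=M(\xi)\widehat\Phi(\xi),\qquad b^{1/2}\,\widehat\Psi(B\xi)=H(\xi)\widehat\Phi(\xi)\qquad\text{for a.e. }\xi\in\mathbb R^n.$$ Let $M^{\uparrow d_j}$ and $H^{\uparrow d_j}$, $1\le j\le p$, be their polyphase components, i.e. the (a.e. unique) measurable $\Lambda^*$-periodic matrix functions with $$M(\xi)=\sum_{j=1}^p e^{2\pi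 i\langle d_j,\xi\rangle}M^{\uparrow d_j}(\xi),\qquad H(\xi)=\sum_{j=1}^p e^{2\pi i\langle d_j,\xi\rangle}H^{\uparrow d_j}(\xi)\qquad\text{for a.e. }\xi.$$ Then $E^{\mathbb Z^n}(\Psi)$ is an orthonormal basis of $V_1\ominus V_0$ if and only if $L=N(p-q)$ and $$\sum_{j=1}^p\begin{bmatrix}M^{\uparrow d_j}(\xi)\\ H^{\uparrow d_j}(\xi)\end{bmatrix}\begin{bmatrix}M^{\uparrow d_j}(\xi)\\ H^{\uparrow d_j}(\xi)\end{bmatrix}^*=\mathbf I_{pN}\qquad\text{for a.e. }\xi\in\mathbb R^n.$$ Equivalently, it is an orthonormal basis of $V_1\ominus V_0$ if and only if $L=N(p-q)$ and the $(qN+L)\times pN$ block matrix $$\begin{bmatrix}M^{\uparrow d_1}(\xi)&\cdots&M^{\uparrow d_p}(\xi)\\ H^{\uparrow d_1}(\xi)&\cdots&H^{\uparrow d_p}(\xi)\end{bmatrix}$$ is unitary for a.e. $\xi$. -/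

import Mathlib

open MeasureTheory FourierTransform
open scoped ENNReal Matrix

namespace RationalDilation

/-- The Euclidean space `ℝⁿ`. -/
abbrev Rn (n : ℕ) : Type := EuclideanSpace ℝ (Fin n)

/-- The Hilbert space `L²(ℝⁿ)` of complex valued functions. -/
abbrev L2 (n : ℕ) : Type := Lp ℂ 2 (volume : Measure (Rn n))

/-- The linear map `x ↦ P x` of `ℝⁿ`. -/
noncomputable abbrev act {n : ℕ} (P : Matrix (Fin n) (Fin n) ℝ) : Rn n →ₗ[ℝ] Rn n :=
  Matrix.toEuclideanLin P

/-- All entries of the real matrix are rational. -/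
def HasRationalEntries {n : ℕ} (P : Matrix (Fin n) (Fin n) ℝ) : Prop :=
  ∀ i j, ∃ r : ℚ, P i j = (r : ℝ)

/-- All complex eigenvalues `z` of the real matrix satisfy `|z| > 1`. -/
def IsExpansive {n : ℕ} (P : Matrix (Fin n) (Fin n) ℝ) : Prop :=
  ∀ z ∈ spectrum ℂ (P.map (fun x : ℝ => (x : ℂ))), 1 < ‖z‖

/-! ### Lattices -/

/-- The standard lattice `ℤⁿ` in `ℝⁿ`. -/
def intLattice (n : ℕ) : AddSubgroup (Rn n) where
  carrier := {x | ∀ i, ∃ m : ℤ, x i = (m : ℝ)}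
  zero_mem' := fun _ => ⟨0, by simp⟩
  add_mem' := by
    intro x y hx hy i
    obtain ⟨a, ha⟩ := hx i
    obtain ⟨b, hb⟩ := hy i
    exact ⟨a + b, by simp [ha, hb]⟩
  neg_mem' := by
    intro x hx i
    obtain ⟨a, ha⟩ := hx i
    exact ⟨-a, by simp [ha]⟩

/-- The lattice `P ℤⁿ`. -/
noncomputable def imageLattice {n : ℕ} (P : Matrix (Fin n) (Fin n) ℝ) : AddSubgroup (Rn n) :=
  (intLattice n).map (act P).toAddMonoidHom

/-- The lattice `Γ = P ℤⁿ + ℤⁿ`. -/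
noncomputable def sumLattice {n : ℕ} (P : Matrix (Fin n) (Fin n) ℝ) : AddSubgroup (Rn n) :=
  imageLattice P ⊔ intLattice n

/-- The dual lattice `Γ^* = {k : ⟨k, γ⟩ ∈ ℤ for all γ ∈ Γ}`. -/
def dualLattice {n : ℕ} (Γ : AddSubgroup (Rn n)) : AddSubgroup (Rn n) where
  carrier := {k | ∀ γ ∈ Γ, ∃ m : ℤ, inner ℝ k γ = (m : ℝ)}
  zero_mem' := fun _ _ => ⟨0, by simp⟩
  add_mem' := by
    intro x y hx hy γ hγ
    obtain ⟨a, ha⟩ := hx γ hγ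
    obtain ⟨b, hb⟩ := hy γ hγ
    exact ⟨a + b, by simp [inner_add_left, ha, hb]⟩
  neg_mem' := by
    intro x hx γ hγ
    obtain ⟨a, ha⟩ := hx γ hγ
    exact ⟨-a, by simp [inner_neg_left, ha]⟩

/-- The family `d` consists of elements of `Γ`, exactly one from each coset of `Γ / Λ`. -/
def IsTransversal {n : ℕ} {ι : Type*} (d : ι → Rn n) (Γ Λ : AddSubgroup (Rn n)) : Prop :=
  (∀ j, d j ∈ Γ) ∧ ∀ γ ∈ Γ, ∃! j, γ - d j ∈ Λ

/-! ### Operators on `L²(ℝⁿ)` -/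

/-- The translation `T_y f (x) = f (x - y)`. -/
noncomputable def translate {n : ℕ} (y : Rn n) (f : L2 n) : L2 n :=
  Lp.compMeasurePreserving (fun x => x - y) (measurePreserving_sub_right volume y) f

lemma act_det {n : ℕ} (A : GL (Fin n) ℝ) :
    LinearMap.det (act (A : Matrix (Fin n) (Fin n) ℝ)) ≠ 0 := by
  have h : LinearMap.det (act (A : Matrix (Fin n) (Fin n) ℝ))
      = (A : Matrix (Fin n) (Fin n) ℝ).det := by
    simp [act, Matrix.toEuclideanLin]
  rw [h]
  exact A.det.ne_zero

lemma map_act {n : ℕ} (A : GL (Fin n) ℝ) :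
    (volume : Measure (Rn n)).map (act (A : Matrix (Fin n) (Fin n) ℝ))
      = ENNReal.ofReal |(LinearMap.det (act (A : Matrix (Fin n) (Fin n) ℝ)))⁻¹| • volume :=
  Measure.map_linearMap_addHaar_eq_smul_addHaar volume (act_det A)

lemma quasiMeasurePreserving_act {n : ℕ} (A : GL (Fin n) ℝ) :
    Measure.QuasiMeasurePreserving (act (A : Matrix (Fin n) (Fin n) ℝ))
      (volume : Measure (Rn n)) volume := by
  refine ⟨(LinearMap.continuous_of_finiteDimensional _).measurable, ?_⟩
  rw [map_act]
  exact Measure.smul_absolutelyContinuous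

lemma memLp_dilate {n : ℕ} (A : GL (Fin n) ℝ) (f : L2 n) :
    MemLp (fun x => (Real.sqrt |(A : Matrix (Fin n) (Fin n) ℝ).det| : ℂ)
      * f (act (A : Matrix (Fin n) (Fin n) ℝ) x)) 2 (volume : Measure (Rn n)) := by
  refine MemLp.const_mul ?_ _
  have h : MemLp f 2 ((volume : Measure (Rn n)).map (act (A : Matrix (Fin n) (Fin n) ℝ))) := by
    rw [map_act]
    exact (Lp.memLp f).smul_measure ENNReal.ofReal_ne_top
  exact h.comp_of_map (quasiMeasurePreserving_act A).aemeasurable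

/-- The dilation `D_A f (x) = |det A|^{1/2} f (A x)`, as a linear map of `L²(ℝⁿ)`. -/
noncomputable def dilate {n : ℕ} (A : GL (Fin n) ℝ) : L2 n →ₗ[ℂ] L2 n where
  toFun f := (memLp_dilate A f).toLp _
  map_add' f g := by
    apply Lp.ext
    refine (MemLp.coeFn_toLp _).trans ?_
    refine Filter.EventuallyEq.trans ?_ (Lp.coeFn_add _ _).symm
    filter_upwards [(quasiMeasurePreserving_act A).ae_eq_comp (Lp.coeFn_add f g),
      (memLp_dilate A f).coeFn_toLp, (memLp_dilate A g).coeFn_toLp] with x h1 h2 h3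
    simp only [Function.comp_apply, Pi.add_apply] at h1 ⊢
    rw [h2, h3, h1, mul_add]
  map_smul' c f := by
    apply Lp.ext
    refine (MemLp.coeFn_toLp _).trans ?_
    refine Filter.EventuallyEq.trans ?_ (Lp.coeFn_smul _ _).symm
    filter_upwards [(quasiMeasurePreserving_act A).ae_eq_comp (Lp.coeFn_smul c f),
      (memLp_dilate A f).coeFn_toLp] with x h1 h2
    simp only [Function.comp_apply, Pi.smul_apply, smul_eq_mul, RingHom.id_apply] at h1 ⊢
    rw [h2, h1]
    ring

/-- The shift invariant system `E^Γ(F) = {T_γ f : f ∈ F, γ ∈ Γ}` as an indexed family. -/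
noncomputable def shiftSystem {n : ℕ} {ι : Type*} (Γ : AddSubgroup (Rn n)) (F : ι → L2 n) :
    ι × Γ → L2 n :=
  fun x => translate (x.2 : Rn n) (F x.1)

/-- The family `v` is an orthonormal basis of the closed subspace `W`. -/
def IsOrthonormalBasisOf {n : ℕ} {ι : Type*} (v : ι → L2 n) (W : Submodule ℂ (L2 n)) : Prop :=
  Orthonormal ℂ v ∧ (Submodule.span ℂ (Set.range v)).topologicalClosure = W

/-! ### Filters and polyphase components -/

/-- `R` is a filter of the vector function `F` with respect to `Φ`: a measurable, `Γ^*`-periodic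
matrix function with `b^{1/2} F^(B ξ) = R(ξ) Φ^(ξ)` for a.e. `ξ`, where `Γ = A ℤⁿ + ℤⁿ`, `B` is the
transpose of `A`, `b = |det A|`, and `^` denotes the Fourier transform on `L²(ℝⁿ)`. -/
def IsFilter {n N : ℕ} {ι : Type*} (A : GL (Fin n) ℝ) (Φ : Fin N → L2 n) (F : ι → L2 n)
    (R : Rn n → Matrix ι (Fin N) ℂ) : Prop :=
  (∀ i m, Measurable fun ξ => R ξ i m) ∧
  (∀ κ ∈ dualLattice (sumLattice (A : Matrix (Fin n) (Fin n) ℝ)), ∀ ξ, R (ξ + κ) = R ξ) ∧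
  ∀ᵐ ξ : Rn n,
    (fun i => (Real.sqrt |(A : Matrix (Fin n) (Fin n) ℝ).det| : ℂ)
      * (𝓕 (F i) : L2 n) (act (A : Matrix (Fin n) (Fin n) ℝ)ᵀ ξ))
    = R ξ *ᵥ fun m => (𝓕 (Φ m) : L2 n) ξ

/-- `Q` is the family of polyphase components of the matrix function `R` for the transversal
`d` of `Γ / Λ`: measurable, `Λ^*`-periodic functions with
`R(ξ) = ∑ⱼ e^{2 π i ⟨dⱼ, ξ⟩} Qⱼ(ξ)` for a.e. `ξ`. These conditions determine `Q` up to null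
sets. -/
def IsPolyphase {n N p : ℕ} {ι : Type*} (Λ : AddSubgroup (Rn n)) (d : Fin p → Rn n)
    (R : Rn n → Matrix ι (Fin N) ℂ) (Q : Fin p → Rn n → Matrix ι (Fin N) ℂ) : Prop :=
  (∀ j i m, Measurable fun ξ => Q j ξ i m) ∧
  (∀ j, ∀ κ ∈ dualLattice Λ, ∀ ξ, Q j (ξ + κ) = Q j ξ) ∧
  ∀ᵐ ξ : Rn n,
    R ξ = ∑ j, Complex.exp (2 * Real.pi * Complex.I * (inner ℝ (d j) ξ : ℝ)) • Q j ξ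

/-- The block row `[Q₁ Q₂ … Q_p]`. -/
def blockRow {N p : ℕ} {ι : Type*} (Q : Fin p → Matrix ι (Fin N) ℂ) :
    Matrix ι (Fin p × Fin N) ℂ :=
  Matrix.of fun i x => Q x.1 i x.2

/-- A possibly rectangular matrix is unitary if its adjoint is a two-sided inverse. -/
def IsUnitaryMatrix {ι κ : Type*} [Fintype ι] [Fintype κ] [DecidableEq ι] [DecidableEq κ]
    (C : Matrix ι κ ℂ) : Prop :=
  C * Cᴴ = 1 ∧ Cᴴ * C = 1

end RationalDilation

namespace RationalDilation

/-! Everything is reduced to shifts by the single lattice `ℤⁿ`. Since `Γ` is a disjoint union of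
cosets of `ℤⁿ`, the `qN` functions `T_{k_j} φ^l` have `ℤⁿ`-shifts forming an orthonormal basis of
`V₀` (`isOrthonormalBasisOf_translates`). Since `T_m D_A = D_A T_{Am}` and `Γ` is also the disjoint
union of the cosets `A ℤⁿ - d_j`, the `pN` functions `D_A T_{-d_j} φ^l` do the same for `V₁`
(`isOrthonormalBasisOf_dilates`).

The system of `Ψ` is an orthonormal basis of `V₁ ⊖ V₀` exactly when, joined to the basis of `V₀`, it
is orthonormal and spans `V₁` (`orthonormal_basis_complement_iff`). For a joint system that is
already orthonormal, spanning is a matter of counting generators, `qN + L = pN`: summing `|⟨T_γ F_i,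
G_x⟩|²` in two orders compares the two numbers (`generators_mem_closedSpan_iff`).

Orthonormality is read off on the Fourier side. The inner products of `ℤⁿ`-shifts of `f` and `g` are
the Fourier coefficients of the periodization of the product of `conj f^` with `g^`, so
orthonormality says that the Gram matrix of periodizations is the identity
(`integral_character_mul_eq_iff`). After the substitution `ξ = B⁻¹ η`, the block matrix `C` of
polyphase components is a `ℤⁿ`-periodic matrix expressing the transforms of the joint generators
through those of the generators of `V₁` (`ae_fourier_eq_sum_polyphase`). The latter have Gram matrix
`1`, so, up to transposition, the former have Gram matrix `C Cᴴ`, and the condition is `C Cᴴ = 1`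
(`modulations_orthonormal_iff`). Once the count makes `C` square, this is unitarity. -/

/-! ### Characters and the unit cell -/

/-- The character `e^{2 π i ⟨y, x⟩}` of `ℝⁿ`. -/
noncomputable def character {n : ℕ} (y x : Rn n) : ℂ :=
  Complex.exp (2 * Real.pi * Complex.I * (inner ℝ y x : ℝ))

lemma norm_character {n : ℕ} (y x : Rn n) : ‖character y x‖ = 1 := by
  have h : (2 * Real.pi * Complex.I * (inner ℝ y x : ℝ) : ℂ)
      = ((2 * Real.pi * inner ℝ y x : ℝ) : ℂ) * Complex.I := by push_cast; ring
  rw [character, h, Complex.norm_exp_ofReal_mul_I]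

lemma continuous_character {n : ℕ} (y : Rn n) : Continuous (character y) := by
  unfold character
  fun_prop

lemma character_add_left {n : ℕ} (y z x : Rn n) :
    character (y + z) x = character y x * character z x := by
  simp only [character, inner_add_left, ← Complex.exp_add]
  congr 1
  push_cast
  ring

lemma character_add_right {n : ℕ} (y x z : Rn n) :
    character y (x + z) = character y x * character y z := by
  simp only [character, inner_add_right, ← Complex.exp_add]
  congr 1
  push_cast
  ring

lemma character_zero {n : ℕ} (x : Rn n) : character 0 x = 1 := by
  simp [character]

lemma character_eq_one {n : ℕ} {y x : Rn n} (h : ∃ m : ℤ, inner ℝ y x = (m : ℝ)) :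
    character y x = 1 := by
  obtain ⟨m, hm⟩ := h
  rw [character, hm, Complex.exp_eq_one_iff]
  exact ⟨m, by push_cast; ring⟩

/-- The element of the standard lattice with the given integer coordinates. -/
noncomputable def latticePoint {n : ℕ} (m : Fin n → ℤ) : intLattice n :=
  ⟨WithLp.toLp 2 fun i => (m i : ℝ), fun i => ⟨m i, rfl⟩⟩

lemma latticePoint_surjective {n : ℕ} : Function.Surjective (latticePoint (n := n)) := by
  rintro ⟨x, hx⟩
  choose m hm using id hx
  refine ⟨m, Subtype.ext ?_⟩
  ext i
  simp [latticePoint, hm]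

instance countable_intLattice {n : ℕ} : Countable (intLattice n) :=
  latticePoint_surjective.countable

lemma exists_int_inner_intLattice {n : ℕ} (x y : intLattice n) :
    ∃ m : ℤ, inner ℝ (x : Rn n) (y : Rn n) = (m : ℝ) := by
  obtain ⟨a, rfl⟩ := latticePoint_surjective x
  obtain ⟨b, rfl⟩ := latticePoint_surjective y
  refine ⟨∑ i, b i * a i, ?_⟩
  simp [latticePoint, PiLp.inner_apply]

lemma character_periodic {n : ℕ} (m γ : intLattice n) (x : Rn n) :
    character (m : Rn n) ((γ : Rn n) + x) = character (m : Rn n) x := by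
  rw [character_add_right, character_eq_one (exists_int_inner_intLattice m γ), one_mul]

/-- The half-open unit cell `[0, 1)ⁿ`. -/
def unitCell (n : ℕ) : Set (Rn n) := {x | ∀ i, x i ∈ Set.Ico (0 : ℝ) 1}

lemma measurableSet_unitCell {n : ℕ} : MeasurableSet (unitCell n) := by
  simp only [unitCell, Set.ofPred_forall]
  refine MeasurableSet.iInter fun i => ?_
  have : Measurable fun x : Rn n => x i := by fun_prop
  exact this measurableSet_Ico

lemma volume_unitCell {n : ℕ} : volume (unitCell n) = 1 := by
  have h : unitCell n = (WithLp.ofLp : Rn n → Fin n → ℝ) ⁻¹' (Set.univ.pi fun _ => Set.Ico 0 1) := by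
    ext x
    simp [unitCell]
  rw [h, (PiLp.volume_preserving_ofLp (Fin n)).measure_preimage
    (MeasurableSet.univ_pi fun _ => measurableSet_Ico).nullMeasurableSet]
  simp [Real.volume_pi_Ico]

lemma isAddFundamentalDomain_unitCell {n : ℕ} :
    IsAddFundamentalDomain (intLattice n) (unitCell n) (volume : Measure (Rn n)) := by
  refine IsAddFundamentalDomain.mk' measurableSet_unitCell.nullMeasurableSet fun x => ?_
  refine ⟨latticePoint fun i => -⌊x i⌋, ?_, ?_⟩
  · intro i
    have h1 := Int.floor_le (x i)
    have h2 := Int.lt_floor_add_one (x i)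
    simp only [AddSubgroup.vadd_def, latticePoint, vadd_eq_add, PiLp.add_apply, Int.cast_neg]
    constructor <;> linarith
  · intro g hg
    obtain ⟨m, rfl⟩ := latticePoint_surjective g
    congr 1
    funext i
    have h := hg i
    simp only [AddSubgroup.vadd_def, latticePoint, vadd_eq_add, PiLp.add_apply, Set.mem_Ico] at h
    have : ⌊x i⌋ = -m i := by
      rw [Int.floor_eq_iff]
      push_cast
      constructor <;> linarith
    omega

/-! ### Uniqueness of Fourier coefficients -/

/-- The projection of `ℝⁿ` to the torus. -/
noncomputable def toTorus {n : ℕ} (x : Rn n) : UnitAddTorus (Fin n) := fun i => (x i : UnitAddCircle)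

lemma continuous_toTorus {n : ℕ} : Continuous (toTorus (n := n)) := by
  unfold toTorus
  refine continuous_pi fun i => ?_
  exact (AddCircle.continuous_mk' 1).comp (by fun_prop : Continuous fun x : Rn n => x i)

lemma toTorus_injOn {n : ℕ} : Set.InjOn (toTorus (n := n)) (unitCell n) := by
  intro x hx y hy h
  ext i
  have hi := congrFun h i
  simp only [toTorus] at hi
  have := Fact.mk (zero_lt_one' ℝ)
  exact (AddCircle.coe_eq_coe_iff_of_mem_Ico (a := 0) (by simpa using hx i)
    (by simpa using hy i)).1 hi

lemma mFourier_toTorus {n : ℕ} (m : Fin n → ℤ) (x : Rn n) :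
    UnitAddTorus.mFourier m (toTorus x) = character (latticePoint m : Rn n) x := by
  simp only [UnitAddTorus.mFourier, ContinuousMap.coe_mk, toTorus, fourier_coe_apply, character,
    ← Complex.exp_sum]
  congr 1
  simp only [latticePoint, PiLp.inner_apply]
  push_cast
  rw [Finset.mul_sum]
  refine Finset.sum_congr rfl fun i _ => ?_
  simp
  ring

lemma integrable_mul_torus {n : ℕ} {μ : Measure (Rn n)} {U : Rn n → ℂ} (hU : Integrable U μ)
    (f : C(UnitAddTorus (Fin n), ℂ)) : Integrable (fun x => f (toTorus x) * U x) μ :=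
  hU.bdd_mul (f.continuous.comp continuous_toTorus).aestronglyMeasurable
    (.of_forall fun x => f.norm_coe_le_norm (toTorus x))

/-- Integration against `U` is a continuous functional for the sup norm, because `U` is integrable,
and trigonometric polynomials are dense in the continuous functions on the torus. -/
lemma integral_mul_torus_eq_zero {n : ℕ} {μ : Measure (Rn n)} {U : Rn n → ℂ}
    (hU : Integrable U μ) (h : ∀ m : intLattice n, ∫ x, character (m : Rn n) x * U x ∂μ = 0)
    (f : C(UnitAddTorus (Fin n), ℂ)) : ∫ x, f (toTorus x) * U x ∂μ = 0 := by
  let T : C(UnitAddTorus (Fin n), ℂ) →ₗ[ℂ] ℂ :=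
    { toFun := fun f => ∫ x, f (toTorus x) * U x ∂μ
      map_add' := fun f g => by
        simp only [ContinuousMap.add_apply, add_mul]
        exact integral_add (integrable_mul_torus hU f) (integrable_mul_torus hU g)
      map_smul' := fun c f => by
        simp only [ContinuousMap.smul_apply, smul_eq_mul, mul_assoc, RingHom.id_apply]
        exact integral_const_mul _ _ }
  let T' : C(UnitAddTorus (Fin n), ℂ) →L[ℂ] ℂ := T.mkContinuous (∫ x, ‖U x‖ ∂μ) fun f => by
    rw [mul_comm, ← integral_const_mul]
    refine norm_integral_le_of_norm_le (hU.norm.const_mul _) (.of_forall fun x => ?_)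
    rw [norm_mul]
    exact mul_le_mul_of_nonneg_right (f.norm_coe_le_norm _) (norm_nonneg _)
  have hle : (Submodule.span ℂ (Set.range (UnitAddTorus.mFourier (d := Fin n)))).topologicalClosure
      ≤ LinearMap.ker T'.toLinearMap := by
    refine Submodule.topologicalClosure_minimal _ (Submodule.span_le.2 ?_) T'.isClosed_ker
    rintro _ ⟨m, rfl⟩
    change ∫ x, UnitAddTorus.mFourier m (toTorus x) * U x ∂μ = 0
    simp only [mFourier_toTorus]
    exact h _
  rw [UnitAddTorus.span_mFourier_closure_eq_top] at hle
  exact hle (Submodule.mem_top (x := f))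

/-- `U` is only integrable, so completeness of the exponentials in `L²` is not enough. Instead the
complex measure `U dμ`, pushed to the torus, is shown to vanish: on closed sets by continuous
approximation, then on Borel sets by the π-λ theorem. -/
lemma setIntegral_preimage_toTorus_eq_zero {n : ℕ} {μ : Measure (Rn n)} {U : Rn n → ℂ}
    (hU : Integrable U μ) (h : ∀ m : intLattice n, ∫ x, character (m : Rn n) x * U x ∂μ = 0)
    {S : Set (UnitAddTorus (Fin n))} (hS : MeasurableSet S) :
    ∫ x in toTorus ⁻¹' S, U x ∂μ = 0 := by
  have hmeas : Measurable (toTorus (n := n)) := continuous_toTorus.measurable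
  have htot : ∫ x, U x ∂μ = 0 := by simpa [character_zero] using h 0
  refine MeasurableSpace.induction_on_inter
    (C := fun S _ => ∫ x in toTorus ⁻¹' S, U x ∂μ = 0) ?_ isPiSystem_isClosed ?_ ?_ ?_ ?_ S hS
  · rw [← borel_eq_generateFrom_isClosed]
    exact BorelSpace.measurable_eq
  · simp
  · intro K hK
    rw [← integral_indicator (hmeas hK.measurableSet)]
    have hK' : IsClosed K := hK
    -- Continuous functions bounded by `1` converging pointwise to the indicator of `K`; dominated
    -- convergence passes to the limit.
    let g : ℕ → C(UnitAddTorus (Fin n), ℂ) := fun j =>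
      ⟨fun t => ((hK'.apprSeq j t : ℝ) : ℂ), by fun_prop⟩
    have hz : ∀ j, ∫ x, g j (toTorus x) * U x ∂μ = 0 :=
      fun j => integral_mul_torus_eq_zero hU h (g j)
    have hlim : Filter.Tendsto (fun j => ∫ x, g j (toTorus x) * U x ∂μ) Filter.atTop
        (nhds (∫ x, (toTorus ⁻¹' K).indicator U x ∂μ)) := by
      refine tendsto_integral_of_dominated_convergence (fun x => ‖U x‖)
        (fun j => (integrable_mul_torus hU (g j)).aestronglyMeasurable) hU.norm ?_ ?_
      · intro j
        refine .of_forall fun x => ?_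
        rw [norm_mul]
        refine mul_le_of_le_one_left (norm_nonneg _) ?_
        have := HasOuterApproxClosed.apprSeq_apply_le_one hK' j (toTorus x)
        simpa [g] using this
      · refine .of_forall fun x => ?_
        have h1 := (tendsto_pi_nhds.1 (HasOuterApproxClosed.tendsto_apprSeq hK')) (toTorus x)
        have h2 : Filter.Tendsto (fun j => g j (toTorus x)) Filter.atTop
            (nhds (((K.indicator (fun _ => (1 : NNReal)) (toTorus x) : NNReal) : ℝ) : ℂ)) :=
          (Complex.continuous_ofReal.tendsto _).comp ((NNReal.continuous_coe.tendsto _).comp h1)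
        have h3 := h2.mul_const (U x)
        convert h3 using 2
        by_cases hx : toTorus x ∈ K <;> simp [Set.indicator, hx]
    simp only [hz] at hlim
    exact tendsto_nhds_unique hlim tendsto_const_nhds
  · intro t ht h0
    rw [Set.preimage_compl, setIntegral_compl (hmeas ht) hU, htot, h0, sub_zero]
  · intro f hd hf h0
    rw [Set.preimage_iUnion, integral_iUnion (fun i => hmeas (hf i))
      (fun i j hij => (hd hij).preimage _) hU.integrableOn]
    simp [h0]

/-- An integrable function on the unit cell with vanishing Fourier coefficients is zero. -/
lemma ae_eq_zero_of_fourier_eq_zero {n : ℕ} {U : Rn n → ℂ}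
    (hU : IntegrableOn U (unitCell n))
    (h : ∀ m : intLattice n, ∫ x in unitCell n, character (m : Rn n) x * U x = 0) :
    U =ᵐ[volume.restrict (unitCell n)] 0 := by
  refine Integrable.ae_eq_zero_of_forall_setIntegral_eq_zero hU fun s hs _ => ?_
  have hs' := hs.inter (measurableSet_unitCell (n := n))
  -- By Lusin-Souslin the injective image of a Borel set is Borel. Within the cell, `s` is thus the
  -- preimage of a Borel set of the torus.
  have him : MeasurableSet (toTorus '' (s ∩ unitCell n)) :=
    hs'.image_of_measurable_injOn continuous_toTorus.measurable
      (toTorus_injOn.mono Set.inter_subset_right)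
  have := setIntegral_preimage_toTorus_eq_zero hU h him
  rw [Measure.restrict_restrict (continuous_toTorus.measurable him)] at this
  rw [Measure.restrict_restrict hs, ← this]
  congr 2
  ext x
  constructor
  · exact fun hx => ⟨⟨x, hx, rfl⟩, hx.2⟩
  · rintro ⟨⟨y, hy, hxy⟩, hx⟩
    exact toTorus_injOn hy.2 hx hxy ▸ hy

/-! ### Periodization over the standard lattice -/

/-- The periodization of a function on `ℝⁿ` over the lattice `ℤⁿ`. -/
noncomputable def periodization {n : ℕ} (u : Rn n → ℂ) (ξ : Rn n) : ℂ :=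
  ∑' k : intLattice n, u (k + ξ)

lemma ae_of_ae_unitCell {n : ℕ} {P : Rn n → Prop}
    (hinv : ∀ (k : intLattice n) (ξ : Rn n), P (k + ξ) ↔ P ξ)
    (h : ∀ᵐ ξ ∂volume.restrict (unitCell n), P ξ) : ∀ᵐ ξ : Rn n, P ξ := by
  rw [ae_iff] at h ⊢
  rw [Measure.restrict_apply' measurableSet_unitCell] at h
  refine isAddFundamentalDomain_unitCell.measure_zero_of_invariant _ (fun g => ?_) h
  ext ξ
  rw [Set.mem_vadd_set_iff_neg_vadd_mem]
  exact not_congr (hinv (-g) ξ)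

lemma ae_forall_translate {n : ℕ} {P : Rn n → Prop} (h : ∀ᵐ ξ : Rn n, P ξ) :
    ∀ᵐ ξ : Rn n, ∀ k : intLattice n, P (k + ξ) :=
  ae_all_iff.2 fun k => (measurePreserving_add_left volume (k : Rn n)).quasiMeasurePreserving.ae h

lemma summable_translate_iff {n : ℕ} (u : Rn n → ℂ) (k : intLattice n) (ξ : Rn n) :
    (Summable fun l : intLattice n => u (l + (k + ξ))) ↔
      Summable fun l : intLattice n => u (l + ξ) := by
  rw [← (Equiv.addRight k).summable_iff (f := fun l : intLattice n => u (l + ξ))]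
  simp only [Function.comp_def, Equiv.coe_addRight, AddSubgroup.coe_add, add_assoc]

lemma periodization_translate {n : ℕ} (u : Rn n → ℂ) (k : intLattice n) (ξ : Rn n) :
    periodization u (k + ξ) = periodization u ξ := by
  rw [periodization, periodization,
    ← (Equiv.addRight k).tsum_eq (fun l : intLattice n => u (l + ξ))]
  simp only [Equiv.coe_addRight, AddSubgroup.coe_add, add_assoc]

lemma aestronglyMeasurable_translate {n : ℕ} {u : Rn n → ℂ} (hu : Integrable u)
    (k : intLattice n) :
    AEStronglyMeasurable (fun ξ => u (k + ξ)) (volume.restrict (unitCell n)) :=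
  (hu.comp_add_left (k : Rn n)).aestronglyMeasurable.restrict

lemma tsum_lintegral_translate {n : ℕ} {u : Rn n → ℂ} :
    ∑' k : intLattice n, ∫⁻ ξ in unitCell n, ‖u (k + ξ)‖ₑ = ∫⁻ ξ, ‖u ξ‖ₑ :=
  (isAddFundamentalDomain_unitCell.lintegral_eq_tsum'' fun ξ => ‖u ξ‖ₑ).symm

lemma lintegral_tsum_translate_lt_top {n : ℕ} {u : Rn n → ℂ} (hu : Integrable u) :
    ∫⁻ ξ in unitCell n, ∑' k : intLattice n, ‖u (k + ξ)‖ₑ < ∞ := by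
  rw [lintegral_tsum fun k => (aestronglyMeasurable_translate hu k).enorm,
    tsum_lintegral_translate]
  exact hu.2

/-- By Tonelli the sum of `‖u (k + ξ)‖` over `k` integrates over the cell to the `L¹` norm of `u`,
hence is finite almost everywhere there; summability is invariant under lattice shifts. -/
lemma ae_summable_translate {n : ℕ} {u : Rn n → ℂ} (hu : Integrable u) :
    ∀ᵐ ξ : Rn n, Summable fun k : intLattice n => u (k + ξ) := by
  refine ae_of_ae_unitCell (fun k ξ => summable_translate_iff u k ξ) ?_
  have hm : AEMeasurable (fun ξ => ∑' k : intLattice n, ‖u (k + ξ)‖ₑ)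
      (volume.restrict (unitCell n)) :=
    AEMeasurable.tsum fun k => (aestronglyMeasurable_translate hu k).enorm
  filter_upwards [ae_lt_top' hm (lintegral_tsum_translate_lt_top hu).ne] with ξ hξ
  have h : Summable fun k : intLattice n => ‖u (k + ξ)‖₊ :=
    ENNReal.tsum_coe_ne_top_iff_summable.1 hξ.ne
  exact Summable.of_norm (NNReal.summable_coe.2 h)

lemma integrableOn_periodization {n : ℕ} {u : Rn n → ℂ} (hu : Integrable u) :
    IntegrableOn (periodization u) (unitCell n) := by
  refine ⟨?_, ?_⟩
  · refine aestronglyMeasurable_of_tendsto_ae (Filter.atTop : Filter (Finset (intLattice n)))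
      (f := fun s ξ => ∑ k ∈ s, u (k + ξ)) (fun s => ?_) ?_
    · exact Finset.aestronglyMeasurable_fun_sum s fun k _ => aestronglyMeasurable_translate hu k
    · filter_upwards [ae_restrict_of_ae (ae_summable_translate hu)] with ξ hξ
      exact hξ.hasSum
  · refine lt_of_le_of_lt (lintegral_mono fun ξ => ?_) (lintegral_tsum_translate_lt_top hu)
    exact enorm_tsum_le_tsum_enorm

/-- Cutting `ℝⁿ` into translates of the cell leaves the character unchanged, by periodicity;
absolute integrability allows the sum to enter the integral. -/
lemma integral_character_mul {n : ℕ} {u : Rn n → ℂ} (hu : Integrable u) (m : intLattice n) :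
    ∫ ξ, character (m : Rn n) ξ * u ξ
      = ∫ ξ in unitCell n, character (m : Rn n) ξ * periodization u ξ := by
  have hcu : Integrable fun ξ => character (m : Rn n) ξ * u ξ :=
    hu.bdd_mul (c := 1) (continuous_character _).aestronglyMeasurable
      (.of_forall fun ξ => (norm_character _ ξ).le)
  rw [isAddFundamentalDomain_unitCell.integral_eq_tsum'' _ hcu]
  rw [← integral_tsum]
  · refine integral_congr_ae (.of_forall fun ξ => ?_)
    simp only [AddSubgroup.vadd_def, vadd_eq_add, character_periodic, tsum_mul_left, periodization]
  · exact fun k => aestronglyMeasurable_translate hcu k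
  · have := tsum_lintegral_translate (u := fun ξ => character (m : Rn n) ξ * u ξ)
    simp only [AddSubgroup.vadd_def, vadd_eq_add]
    rw [this]
    exact hcu.2.ne

-- For `m ≠ 0`, shift the cell by a vector `t` with `⟨m, t⟩ = 1/2`. This negates the character, but
-- the shifted cell is again a fundamental domain, so the integral equals its own negative.
open scoped Pointwise in
lemma setIntegral_character {n : ℕ} (m : intLattice n) :
    ∫ ξ in unitCell n, character (m : Rn n) ξ = if m = 0 then 1 else 0 := by
  split_ifs with hm
  · subst hm
    simp [character_zero, measureReal_def, volume_unitCell]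
  · set t : Rn n := (2 * ‖(m : Rn n)‖ ^ 2)⁻¹ • (m : Rn n) with ht
    have hm' : (m : Rn n) ≠ 0 := fun h => hm (Subtype.ext h)
    have hval : character (m : Rn n) t = -1 := by
      have : inner ℝ (m : Rn n) t = 1 / 2 := by
        rw [ht, inner_smul_right, real_inner_self_eq_norm_sq]
        have := norm_ne_zero_iff.2 hm'
        field_simp
      rw [character, this, ← Complex.exp_pi_mul_I]
      congr 1
      push_cast
      ring
    have hfd := (isAddFundamentalDomain_unitCell (n := n)).vadd_of_comm t
    have h1 := hfd.setIntegral_eq isAddFundamentalDomain_unitCell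
      (f := character (m : Rn n)) fun g x => character_periodic m g x
    have h2 : ∫ ξ in t +ᵥ unitCell n, character (m : Rn n) ξ
        = ∫ ξ in unitCell n, character (m : Rn n) (t + ξ) := by
      have hme : MeasurableEmbedding (fun ξ : Rn n => t + ξ) := measurableEmbedding_addLeft t
      have := (measurePreserving_add_left volume t).setIntegral_image_emb hme
        (character (m : Rn n)) (unitCell n)
      exact this
    simp only [character_add_right, hval, neg_mul, one_mul, integral_neg] at h2
    rw [h1] at h2
    exact self_eq_neg.1 h2

/-- The Fourier coefficients of an integrable function at lattice points are those of the constant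
`c` if and only if its periodization is the constant `c`. -/
lemma integral_character_mul_eq_iff {n : ℕ} {u : Rn n → ℂ} (hu : Integrable u) (c : ℂ) :
    (∀ m : intLattice n, ∫ ξ, character (m : Rn n) ξ * u ξ = if m = 0 then c else 0) ↔
      ∀ᵐ ξ : Rn n, periodization u ξ = c := by
  have hc : ∀ m : intLattice n,
      ∫ ξ in unitCell n, character (m : Rn n) ξ * c = if m = 0 then c else 0 := by
    intro m
    rw [integral_mul_const, setIntegral_character]
    split_ifs <;> simp
  have hfin : volume (unitCell n) ≠ ∞ := by simp [volume_unitCell]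
  constructor
  · intro h
    refine ae_of_ae_unitCell (fun k ξ => by rw [periodization_translate]) ?_
    have hint : IntegrableOn (fun _ : Rn n => c) (unitCell n) := integrableOn_const hfin
    have h0 := ae_eq_zero_of_fourier_eq_zero
      (U := fun ξ => periodization u ξ - c) ((integrableOn_periodization hu).sub hint) fun m => by
        have hb : ∀ {v : Rn n → ℂ}, IntegrableOn v (unitCell n) →
            IntegrableOn (fun ξ => character (m : Rn n) ξ * v ξ) (unitCell n) := fun hv =>
          hv.bdd_mul (c := 1) (continuous_character _).aestronglyMeasurable
            (.of_forall fun ξ => (norm_character _ ξ).le)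
        simp only [mul_sub]
        rw [integral_sub (hb (integrableOn_periodization hu)) (hb hint),
          ← integral_character_mul hu, h, hc, sub_self]
    filter_upwards [h0] with ξ hξ
    exact sub_eq_zero.1 hξ
  · intro h m
    rw [integral_character_mul hu, ← hc m]
    refine integral_congr_ae ?_
    filter_upwards [ae_restrict_of_ae h] with ξ hξ
    rw [hξ]

lemma integrable_conj_mul {n : ℕ} {f g : Rn n → ℂ} (hf : MemLp f 2) (hg : MemLp g 2) :
    Integrable fun ξ => (starRingEnd ℂ) (f ξ) * g ξ :=
  MemLp.integrable_mul hf.star hg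

/-- If the functions `F` are combinations, with periodic coefficient matrix `C`, of functions `G`
whose modulations are orthonormal, then the modulations of the `F` are orthonormal if and only if
`C Cᴴ = 1` almost everywhere. -/
lemma modulations_orthonormal_iff {n : ℕ} {I X : Type*} [Fintype I] [Fintype X] [DecidableEq I]
    [DecidableEq X] {G : X → Rn n → ℂ} (hG : ∀ x, MemLp (G x) 2)
    (hGo : ∀ x y, ∀ m : intLattice n, ∫ ξ, character (m : Rn n) ξ
      * ((starRingEnd ℂ) (G x ξ) * G y ξ) = if m = 0 then (if x = y then 1 else 0) else 0)
    {F : I → Rn n → ℂ} (hF : ∀ i, MemLp (F i) 2) {C : Rn n → Matrix I X ℂ}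
    (hC : ∀ (k : intLattice n) ξ, C (k + ξ) = C ξ)
    (hFC : ∀ i, ∀ᵐ ξ, F i ξ = ∑ x, C ξ i x * G x ξ) :
    (∀ i j, ∀ m : intLattice n, ∫ ξ, character (m : Rn n) ξ
      * ((starRingEnd ℂ) (F i ξ) * F j ξ) = if m = 0 then (if i = j then 1 else 0) else 0) ↔
      ∀ᵐ ξ, C ξ * (C ξ)ᴴ = 1 := by
  -- Periodicity takes the entries of `C` out of the sum over the lattice, leaving the Gram matrix
  -- of `G`, which is the identity. The indices come out as `j i` because conjugation falls on the
  -- first factor.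
  have key : ∀ᵐ ξ : Rn n, ∀ i j,
      periodization (fun ξ => (starRingEnd ℂ) (F i ξ) * F j ξ) ξ = (C ξ * (C ξ)ᴴ) j i := by
    have h1 := ae_forall_translate (ae_all_iff.2 hFC)
    have h2 : ∀ᵐ ξ : Rn n, ∀ x y, Summable fun k : intLattice n =>
        (starRingEnd ℂ) (G x (k + ξ)) * G y (k + ξ) := by
      rw [ae_all_iff]
      intro x
      rw [ae_all_iff]
      intro y
      have hxy := integrable_conj_mul (hG x) (hG y)
      exact ae_summable_translate (u := fun ξ => (starRingEnd ℂ) (G x ξ) * G y ξ) hxy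
    have h3 : ∀ᵐ ξ : Rn n, ∀ x y, periodization (fun ξ => (starRingEnd ℂ) (G x ξ) * G y ξ) ξ
        = if x = y then 1 else 0 := by
      rw [ae_all_iff]
      intro x
      rw [ae_all_iff]
      intro y
      have hxy := integrable_conj_mul (hG x) (hG y)
      exact (integral_character_mul_eq_iff hxy _).1 (hGo x y)
    filter_upwards [h1, h2, h3] with ξ h1 h2 h3 i j
    have hexp : ∀ k : intLattice n, (starRingEnd ℂ) (F i (k + ξ)) * F j (k + ξ)
        = ∑ x, ∑ y, ((starRingEnd ℂ) (C ξ i x) * C ξ j y)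
          * ((starRingEnd ℂ) (G x (k + ξ)) * G y (k + ξ)) := by
      intro k
      rw [h1 k i, h1 k j, hC, map_sum, Finset.sum_mul_sum]
      refine Finset.sum_congr rfl fun x _ => Finset.sum_congr rfl fun y _ => ?_
      rw [map_mul]
      ring
    have hs := hasSum_sum (s := Finset.univ) fun x (_ : x ∈ Finset.univ) =>
      hasSum_sum (s := Finset.univ) fun y (_ : y ∈ Finset.univ) =>
        (h2 x y).hasSum.mul_left ((starRingEnd ℂ) (C ξ i x) * C ξ j y)
    simp only [← hexp] at hs
    rw [periodization, hs.tsum_eq, Matrix.mul_apply]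
    refine Finset.sum_congr rfl fun x _ => ?_
    have h4 : ∀ y, ∑' k : intLattice n, (starRingEnd ℂ) (G x (k + ξ)) * G y (k + ξ)
      = if x = y then 1 else 0 := h3 x
    simp only [h4]
    simp [mul_comm]
  have hiff : ∀ i j, (∀ m : intLattice n, ∫ ξ, character (m : Rn n) ξ
      * ((starRingEnd ℂ) (F i ξ) * F j ξ) = if m = 0 then (if i = j then 1 else 0) else 0) ↔
      ∀ᵐ ξ : Rn n, periodization (fun ξ => (starRingEnd ℂ) (F i ξ) * F j ξ) ξ
        = if i = j then 1 else 0 := by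
    intro i j
    have hij := integrable_conj_mul (hF i) (hF j)
    exact integral_character_mul_eq_iff hij _
  simp only [hiff, ← ae_all_iff]
  refine Filter.eventually_congr ?_
  filter_upwards [key] with ξ hξ
  simp only [hξ]
  rw [← Matrix.ext_iff]
  simp only [Matrix.one_apply]
  exact ⟨fun h i j => (h j i).trans (by simp [eq_comm]),
    fun h i j => (h j i).trans (by simp [eq_comm])⟩

/-! ### Translations and the Fourier transform -/

lemma coeFn_translate {n : ℕ} (y : Rn n) (f : L2 n) :
    translate y f =ᵐ[volume] fun x => f (x - y) :=
  Lp.coeFn_compMeasurePreserving f (measurePreserving_sub_right volume y)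

lemma translate_zero {n : ℕ} (f : L2 n) : translate 0 f = f := by
  apply Lp.ext
  filter_upwards [coeFn_translate 0 f] with x hx
  rw [hx, sub_zero]

lemma translate_translate {n : ℕ} (y z : Rn n) (f : L2 n) :
    translate y (translate z f) = translate (y + z) f := by
  apply Lp.ext
  filter_upwards [coeFn_translate y (translate z f), coeFn_translate (y + z) f,
    (measurePreserving_sub_right volume y).quasiMeasurePreserving.ae (coeFn_translate z f)]
    with x h1 h2 h3
  rw [h1, h2, h3, sub_sub]

/-- Translation as a linear isometry of `L²(ℝⁿ)`. -/
noncomputable def translateIsometry {n : ℕ} (y : Rn n) : L2 n →ₗᵢ[ℂ] L2 n :=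
  Lp.compMeasurePreservingₗᵢ ℂ (fun x => x - y) (measurePreserving_sub_right volume y)

lemma norm_translate {n : ℕ} (y : Rn n) (f : L2 n) : ‖translate y f‖ = ‖f‖ :=
  (translateIsometry y).norm_map f

lemma inner_translate_translate {n : ℕ} (y z : Rn n) (f g : L2 n) :
    inner ℂ (translate y f) (translate z g) = inner ℂ f (translate (z - y) g) := by
  have h : translate z g = translate y (translate (z - y) g) := by
    rw [translate_translate, add_sub_cancel]
  rw [h]
  exact (translateIsometry y).inner_map_map f _

lemma memLp_modulate {n : ℕ} (y : Rn n) {f : Rn n → ℂ} (hf : MemLp f 2) :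
    MemLp (fun ξ => character y ξ * f ξ) 2 :=
  hf.of_le ((continuous_character y).aestronglyMeasurable.mul hf.1)
    (.of_forall fun ξ => by rw [norm_mul, norm_character, one_mul])

/-- Multiplication by a character on `L²(ℝⁿ)`. -/
noncomputable def modulate {n : ℕ} (y : Rn n) (f : L2 n) : L2 n :=
  (memLp_modulate y (Lp.memLp f)).toLp _

lemma coeFn_modulate {n : ℕ} (y : Rn n) (f : L2 n) :
    modulate y f =ᵐ[volume] fun ξ => character y ξ * f ξ :=
  MemLp.coeFn_toLp _

lemma isometry_modulate {n : ℕ} (y : Rn n) : Isometry (modulate (n := n) y) := by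
  refine Isometry.of_dist_eq fun f g => ?_
  rw [Lp.dist_def, Lp.dist_def]
  congr 1
  refine eLpNorm_congr_norm_ae ?_
  filter_upwards [coeFn_modulate y f, coeFn_modulate y g] with ξ h1 h2
  rw [Pi.sub_apply, Pi.sub_apply, h1, h2, ← mul_sub, norm_mul, norm_character, one_mul]

/-- The translation of a Schwartz function. -/
noncomputable def schwartzTranslate {n : ℕ} (y : Rn n) (f : SchwartzMap (Rn n) ℂ) :
    SchwartzMap (Rn n) ℂ :=
  SchwartzMap.compCLMOfAntilipschitz (K := 1) ℂ (g := fun x : Rn n => x - y)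
    (by fun_prop) (AntilipschitzWith.of_le_mul_dist fun a b => by simp) f

lemma fourier_schwartzTranslate {n : ℕ} (y : Rn n) (f : SchwartzMap (Rn n) ℂ) (ξ : Rn n) :
    𝓕 (schwartzTranslate y f) ξ = character (-y) ξ * 𝓕 f ξ := by
  rw [SchwartzMap.fourier_coe, SchwartzMap.fourier_coe]
  have h1 : (schwartzTranslate y f : Rn n → ℂ) = f ∘ fun v => v + -y := by
    rw [schwartzTranslate, SchwartzMap.compCLMOfAntilipschitz_apply]
    rfl
  rw [h1]
  refine (congrFun (VectorFourier.fourierIntegral_comp_add_right Real.fourierChar volume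
    (innerₗ (Rn n)) f (-y)) ξ).trans ?_
  rw [Circle.smul_def, smul_eq_mul]
  congr 1
  rw [Real.fourierChar_apply, character]
  congr 1
  simp
  ring

lemma toLp_schwartzTranslate {n : ℕ} (y : Rn n) (f : SchwartzMap (Rn n) ℂ) :
    (schwartzTranslate y f).toLp 2 = translate y (f.toLp 2) := by
  apply Lp.ext
  filter_upwards [(schwartzTranslate y f).coeFn_toLp 2, coeFn_translate y (f.toLp 2),
    (measurePreserving_sub_right volume y).quasiMeasurePreserving.ae (f.coeFn_toLp 2 volume)]
    with x h1 h2 h3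
  rw [h1, h2, h3, schwartzTranslate, SchwartzMap.compCLMOfAntilipschitz_apply]
  rfl

/-- Both sides are continuous in `f`, and on the dense set of Schwartz functions the identity is a
change of variables in the Fourier integral. -/
lemma fourier_translate {n : ℕ} (y : Rn n) (f : L2 n) :
    (𝓕 (translate y f) : L2 n) = modulate (-y) (𝓕 f) := by
  have hd : DenseRange (SchwartzMap.toLpCLM ℝ (E := Rn n) ℂ 2 volume) :=
    SchwartzMap.denseRange_toLpCLM ENNReal.ofNat_ne_top
  have h1 : Continuous fun f : L2 n => (𝓕 (translate y f) : L2 n) :=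
    (Lp.fourierTransformₗᵢ (Rn n) ℂ).continuous.comp (translateIsometry y).continuous
  have h2 : Continuous fun f : L2 n => modulate (-y) (𝓕 f : L2 n) :=
    (isometry_modulate (-y)).continuous.comp (Lp.fourierTransformₗᵢ (Rn n) ℂ).continuous
  refine congrFun (hd.equalizer h1 h2 ?_) f
  funext g
  simp only [Function.comp_apply, SchwartzMap.toLpCLM_apply]
  rw [← toLp_schwartzTranslate, SchwartzMap.toLp_fourier_eq, SchwartzMap.toLp_fourier_eq]
  apply Lp.ext
  filter_upwards [(𝓕 (schwartzTranslate y g)).coeFn_toLp 2, (𝓕 g).coeFn_toLp 2,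
    coeFn_modulate (-y) ((𝓕 g).toLp 2)] with ξ h1 h2 h3
  rw [h1, h3, h2, fourier_schwartzTranslate]

lemma coeFn_fourier_translate {n : ℕ} (y : Rn n) (f : L2 n) :
    (𝓕 (translate y f) : L2 n) =ᵐ[volume] fun ξ => character (-y) ξ * (𝓕 f : L2 n) ξ := by
  rw [fourier_translate]
  exact coeFn_modulate _ _

/-- Plancherel, together with translation becoming modulation. -/
lemma inner_translate_eq_integral {n : ℕ} (y : Rn n) (f g : L2 n) :
    inner ℂ f (translate y g) = ∫ ξ, character (-y) ξ
      * ((starRingEnd ℂ) ((𝓕 f : L2 n) ξ) * (𝓕 g : L2 n) ξ) := by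
  rw [← Lp.inner_fourier_eq, L2.inner_def]
  refine integral_congr_ae ?_
  filter_upwards [coeFn_fourier_translate y g] with ξ hξ
  rw [hξ, RCLike.inner_apply]
  ring

/-! ### Linear changes of variables -/

lemma det_act {n : ℕ} (P : Matrix (Fin n) (Fin n) ℝ) : LinearMap.det (act P) = P.det := by
  simp [act, Matrix.toEuclideanLin]

lemma act_act {n : ℕ} (P Q : Matrix (Fin n) (Fin n) ℝ) (x : Rn n) :
    act P (act Q x) = act (P * Q) x := by
  simp [act]

lemma act_one {n : ℕ} (x : Rn n) : act (1 : Matrix (Fin n) (Fin n) ℝ) x = x := by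
  simp [act]

lemma inner_act_transpose {n : ℕ} (P : Matrix (Fin n) (Fin n) ℝ) (x y : Rn n) :
    inner ℝ (act Pᵀ x) y = inner ℝ x (act P y) := by
  simp only [act, EuclideanSpace.inner_eq_star_dotProduct, Matrix.ofLp_toLpLin,
    star_trivial, Matrix.mulVec_transpose, Matrix.toLin'_apply]
  rw [dotProduct_comm, ← Matrix.dotProduct_mulVec, dotProduct_comm]

lemma act_inv_act {n : ℕ} (A : GL (Fin n) ℝ) (x : Rn n) :
    act ((A⁻¹ : GL (Fin n) ℝ) : Matrix (Fin n) (Fin n) ℝ)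
      (act (A : Matrix (Fin n) (Fin n) ℝ) x) = x := by
  rw [act_act, ← Units.val_mul, inv_mul_cancel, Units.val_one, act_one]

lemma act_act_inv {n : ℕ} (A : GL (Fin n) ℝ) (x : Rn n) :
    act (A : Matrix (Fin n) (Fin n) ℝ)
      (act ((A⁻¹ : GL (Fin n) ℝ) : Matrix (Fin n) (Fin n) ℝ) x) = x := by
  rw [act_act, ← Units.val_mul, mul_inv_cancel, Units.val_one, act_one]

lemma continuous_act {n : ℕ} (P : Matrix (Fin n) (Fin n) ℝ) : Continuous (act P) :=
  LinearMap.continuous_of_finiteDimensional _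

/-- The linear automorphism of `ℝⁿ` given by an invertible matrix, as a measurable equivalence. -/
noncomputable def actMeasurableEquiv {n : ℕ} (A : GL (Fin n) ℝ) : Rn n ≃ᵐ Rn n where
  toFun := act (A : Matrix (Fin n) (Fin n) ℝ)
  invFun := act ((A⁻¹ : GL (Fin n) ℝ) : Matrix (Fin n) (Fin n) ℝ)
  left_inv := act_inv_act A
  right_inv := act_act_inv A
  measurable_toFun := (continuous_act _).measurable
  measurable_invFun := (continuous_act _).measurable

lemma integral_comp_act {n : ℕ} (A : GL (Fin n) ℝ) (h : Rn n → ℂ) :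
    ∫ x, h (act (A : Matrix (Fin n) (Fin n) ℝ) x)
      = |(A : Matrix (Fin n) (Fin n) ℝ).det|⁻¹ • ∫ x, h x := by
  have h1 := integral_map_equiv (μ := volume) (actMeasurableEquiv A) h
  change ∫ y, h y ∂(volume.map (act (A : Matrix (Fin n) (Fin n) ℝ))) = _ at h1
  rw [map_act, det_act, integral_smul_measure, ENNReal.toReal_ofReal (abs_nonneg _), abs_inv] at h1
  exact h1.symm

lemma ae_comp_act_iff {n : ℕ} (A : GL (Fin n) ℝ) {P : Rn n → Prop} :
    (∀ᵐ x : Rn n, P (act (A : Matrix (Fin n) (Fin n) ℝ) x)) ↔ ∀ᵐ x : Rn n, P x := by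
  refine ⟨fun h => ?_, fun h => (quasiMeasurePreserving_act A).ae h⟩
  have := (quasiMeasurePreserving_act A⁻¹).ae h
  simpa only [act_act_inv] using this

/-! ### The dilation -/

lemma coeFn_dilate {n : ℕ} (A : GL (Fin n) ℝ) (f : L2 n) :
    dilate A f =ᵐ[volume] fun x => (Real.sqrt |(A : Matrix (Fin n) (Fin n) ℝ).det| : ℂ)
      * f (act (A : Matrix (Fin n) (Fin n) ℝ) x) :=
  (memLp_dilate A f).coeFn_toLp

lemma translate_dilate {n : ℕ} (A : GL (Fin n) ℝ) (y : Rn n) (f : L2 n) :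
    translate y (dilate A f)
      = dilate A (translate (act (A : Matrix (Fin n) (Fin n) ℝ) y) f) := by
  apply Lp.ext
  filter_upwards [coeFn_translate y (dilate A f), coeFn_dilate A (translate (act A.1 y) f),
    (measurePreserving_sub_right volume y).quasiMeasurePreserving.ae (coeFn_dilate A f),
    (quasiMeasurePreserving_act A).ae (coeFn_translate (act A.1 y) f)] with x h1 h2 h3 h4
  rw [h1, h2, h3, h4, map_sub]

lemma sqrt_abs_det_mul_self {n : ℕ} (A : GL (Fin n) ℝ) :
    (Real.sqrt |(A : Matrix (Fin n) (Fin n) ℝ).det| : ℂ)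
      * (Real.sqrt |(A : Matrix (Fin n) (Fin n) ℝ).det| : ℂ)
      = (|(A : Matrix (Fin n) (Fin n) ℝ).det| : ℝ) := by
  rw [← Complex.ofReal_mul, Real.mul_self_sqrt (abs_nonneg _)]

lemma abs_det_ne_zero {n : ℕ} (A : GL (Fin n) ℝ) :
    |(A : Matrix (Fin n) (Fin n) ℝ).det| ≠ 0 :=
  abs_ne_zero.2 A.det.ne_zero

lemma inner_dilate_dilate {n : ℕ} (A : GL (Fin n) ℝ) (f g : L2 n) :
    inner ℂ (dilate A f) (dilate A g) = inner ℂ f g := by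
  rw [L2.inner_def, L2.inner_def]
  have h := integral_comp_act A fun x => inner ℂ (f x) (g x)
  rw [eq_inv_smul_iff₀ (abs_det_ne_zero A)] at h
  rw [← h, ← integral_smul]
  refine integral_congr_ae ?_
  filter_upwards [coeFn_dilate A f, coeFn_dilate A g] with x h1 h2
  rw [h1, h2, RCLike.inner_apply, RCLike.inner_apply, Complex.real_smul,
    ← sqrt_abs_det_mul_self A, map_mul, Complex.conj_ofReal]
  ring

/-- The dilation as a linear isometry. -/
noncomputable def dilateIsometry {n : ℕ} (A : GL (Fin n) ℝ) : L2 n →ₗᵢ[ℂ] L2 n :=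
  (dilate A).isometryOfInner (inner_dilate_dilate A)

/-! ### Orthonormal families in Hilbert spaces -/

section Hilbert

variable {E : Type*} [NormedAddCommGroup E] [InnerProductSpace ℂ E]

lemma mem_closedSpan {ι : Type*} (v : ι → E) (i : ι) :
    v i ∈ (Submodule.span ℂ (Set.range v)).topologicalClosure :=
  Submodule.le_topologicalClosure _ (Submodule.subset_span ⟨i, rfl⟩)

lemma closedSpan_le {ι : Type*} {v : ι → E} {W : Submodule ℂ E} (hW : IsClosed (W : Set E))
    (h : ∀ i, v i ∈ W) : (Submodule.span ℂ (Set.range v)).topologicalClosure ≤ W :=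
  Submodule.topologicalClosure_minimal _
    (Submodule.span_le.2 (by rintro _ ⟨i, rfl⟩; exact h i)) hW

lemma mem_orthogonal_closedSpan {ι : Type*} {v : ι → E} {x : E} (h : ∀ i, inner ℂ (v i) x = 0) :
    x ∈ (Submodule.span ℂ (Set.range v)).topologicalClosureᗮ := by
  rw [Submodule.orthogonal_closure]
  rw [Submodule.mem_orthogonal]
  intro u hu
  induction hu using Submodule.span_induction with
  | mem u hu => obtain ⟨i, rfl⟩ := hu; exact h i
  | zero => exact inner_zero_left _
  | add a b _ _ ha hb => rw [inner_add_left, ha, hb, add_zero]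
  | smul c a _ ha => rw [inner_smul_left, ha, mul_zero]

variable [CompleteSpace E]

/-- Bessel's identity: the coefficients with respect to an orthonormal family compute the norm of
the projection to its closed linear span. -/
lemma hasSum_norm_inner_sq {ι : Type*} {v : ι → E} (hv : Orthonormal ℂ v) (x : E) :
    HasSum (fun i => ‖inner ℂ (v i) x‖ ^ 2)
      (‖(Submodule.span ℂ (Set.range v)).topologicalClosure.starProjection x‖ ^ 2) := by
  set S := (Submodule.span ℂ (Set.range v)).topologicalClosure with hS
  -- Inside its own closed span the family is a Hilbert basis, so Parseval applies to the projection
  -- of `x`.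
  let w : ι → S := fun i => ⟨v i, mem_closedSpan v i⟩
  have hw : Orthonormal ℂ w := hv.codRestrict S _
  have hbot : (Submodule.span ℂ (Set.range w))ᗮ = ⊥ := by
    rw [eq_bot_iff]
    intro y hy
    have h1 : (y : E) ∈ Sᗮ := mem_orthogonal_closedSpan fun i =>
      (Submodule.mem_orthogonal _ _).1 hy (w i) (Submodule.subset_span ⟨i, rfl⟩)
    have h2 := (Submodule.mem_orthogonal _ _).1 h1 y y.2
    exact Subtype.ext (inner_self_eq_zero.1 h2)
  let b := HilbertBasis.mkOfOrthogonalEqBot hw hbot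
  have hsum := b.hasSum_inner_mul_inner (S.orthogonalProjectionOnto x) (S.orthogonalProjectionOnto x)
  have hre := RCLike.hasSum_re ℂ hsum
  rw [inner_self_eq_norm_sq] at hre
  convert hre using 2 with i
  · have hb : b i = w i := congrFun (HilbertBasis.coe_mkOfOrthogonalEqBot hw hbot) i
    have h3 : inner ℂ (b i) (S.orthogonalProjectionOnto x) = inner ℂ (v i) x := by
      rw [hb, Submodule.coe_inner]
      change inner ℂ (v i) (S.starProjection x) = _
      rw [← Submodule.inner_starProjection_left_eq_right,
        Submodule.starProjection_eq_self_iff.2 (mem_closedSpan v i)]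
    rw [← inner_conj_symm (S.orthogonalProjectionOnto x), h3, RCLike.conj_mul]
    norm_cast
  · rfl

/-- An orthonormal family in `V₁` is a basis of the orthogonal complement of `V₀` in `V₁` if and
only if it completes a given orthonormal basis of `V₀` to one of `V₁`. -/
lemma orthonormal_basis_complement_iff {α β : Type*} {u : α → E} {w : β → E}
    {V₀ V₁ : Submodule ℂ E} (hu : Orthonormal ℂ u)
    (huV : (Submodule.span ℂ (Set.range u)).topologicalClosure = V₀) (hV : V₀ ≤ V₁)
    (hV₁ : IsClosed (V₁ : Set E)) (hw : ∀ b, w b ∈ V₁) :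
    (Orthonormal ℂ w ∧ (Submodule.span ℂ (Set.range w)).topologicalClosure = V₁ ⊓ V₀ᗮ) ↔
      Orthonormal ℂ (Sum.elim u w) ∧
        V₁ ≤ (Submodule.span ℂ (Set.range (Sum.elim u w))).topologicalClosure := by
  classical
  have huV₀ : ∀ a, u a ∈ V₀ := fun a => huV ▸ mem_closedSpan u a
  have hV₀ : IsClosed (V₀ : Set E) := huV ▸ Submodule.isClosed_topologicalClosure _
  constructor
  · rintro ⟨ho, hspan⟩
    have hwV : ∀ b, w b ∈ V₀ᗮ := fun b => by
      have h := mem_closedSpan w b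
      rw [hspan] at h
      exact h.2
    refine ⟨?_, ?_⟩
    · rw [orthonormal_iff_ite] at hu ho ⊢
      rintro (a | b) (a' | b')
      · simpa using hu a a'
      · simpa using (Submodule.mem_orthogonal _ _).1 (hwV b') _ (huV₀ a)
      · simpa using (Submodule.mem_orthogonal' _ _).1 (hwV b) _ (huV₀ a')
      · simpa using ho b b'
    · intro x hx
      set T := (Submodule.span ℂ (Set.range (Sum.elim u w))).topologicalClosure with hT
      have hTc : IsClosed (T : Set E) := Submodule.isClosed_topologicalClosure _
      have h1 : V₀ ≤ T := huV ▸ closedSpan_le hTc fun a => mem_closedSpan (Sum.elim u w) (.inl a)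
      have h2 : V₁ ⊓ V₀ᗮ ≤ T :=
        hspan ▸ closedSpan_le hTc fun b => mem_closedSpan (Sum.elim u w) (.inr b)
      have : CompleteSpace V₀ := hV₀.completeSpace_coe
      have h3 : V₀.starProjection x ∈ V₀ := Submodule.starProjection_apply_mem _ _
      -- `V₁` splits as `V₀` plus its complement in `V₁`, and both pieces lie in `T`.
      have h4 : x - V₀.starProjection x ∈ V₁ ⊓ V₀ᗮ :=
        ⟨V₁.sub_mem hx (hV h3), Submodule.sub_starProjection_mem_orthogonal x⟩
      have := T.add_mem (h1 h3) (h2 h4)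
      rwa [add_sub_cancel] at this
  · rintro ⟨ho, hspan⟩
    have hwo : Orthonormal ℂ w := by simpa using ho.comp _ Sum.inr_injective
    have hwV : ∀ b, w b ∈ V₀ᗮ := fun b => by
      rw [← huV]
      refine mem_orthogonal_closedSpan fun a => ?_
      simpa using ho.2 (show (Sum.inl a : α ⊕ β) ≠ Sum.inr b from Sum.inl_ne_inr)
    refine ⟨hwo, le_antisymm ?_ ?_⟩
    · exact closedSpan_le (hV₁.inter (Submodule.isClosed_orthogonal _)) fun b => ⟨hw b, hwV b⟩
    · intro x hx
      set S := (Submodule.span ℂ (Set.range w)).topologicalClosure with hS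
      have hSV : S ≤ V₁ ⊓ V₀ᗮ :=
        closedSpan_le (hV₁.inter (Submodule.isClosed_orthogonal _)) fun b => ⟨hw b, hwV b⟩
      have h3 : S.starProjection x ∈ S := Submodule.starProjection_apply_mem _ _
      have h4 : x - S.starProjection x ∈ Sᗮ := Submodule.sub_starProjection_mem_orthogonal x
      have h5 : x - S.starProjection x ∈ V₁ ⊓ V₀ᗮ := Submodule.sub_mem _ hx (hSV h3)
      -- The residual is orthogonal to every `u a` and every `w b`, hence to a space containing
      -- `V₁`. It lies in `V₁` itself, so it is zero.
      have h6 := mem_orthogonal_closedSpan (v := Sum.elim u w) (x := x - S.starProjection x) (by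
        rintro (a | b)
        · exact (Submodule.mem_orthogonal _ _).1 h5.2 _ (huV₀ a)
        · exact (Submodule.mem_orthogonal _ _).1 h4 _ (mem_closedSpan w b))
      have h7 := (Submodule.mem_orthogonal _ _).1 h6 _ (hspan h5.1)
      rw [inner_self_eq_zero, sub_eq_zero] at h7
      rw [h7]
      exact h3

end Hilbert

lemma IsOrthonormalBasisOf.comp_bijective {n : ℕ} {ι κ : Type*} {v : ι → L2 n}
    {W : Submodule ℂ (L2 n)} (h : IsOrthonormalBasisOf v W) {e : κ → ι}
    (he : Function.Bijective e) : IsOrthonormalBasisOf (v ∘ e) W :=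
  ⟨h.1.comp e he.1, by rw [he.2.range_comp]; exact h.2⟩

lemma IsOrthonormalBasisOf.map_isometry {n : ℕ} {ι : Type*} {v : ι → L2 n}
    {W : Submodule ℂ (L2 n)} (h : IsOrthonormalBasisOf v W) (T : L2 n →ₗᵢ[ℂ] L2 n) :
    IsOrthonormalBasisOf (T ∘ v) (W.map T.toLinearMap) := by
  refine ⟨h.1.comp_linearIsometry T, le_antisymm ?_ ?_⟩
  · refine closedSpan_le ?_ fun i => ⟨v i, h.2 ▸ mem_closedSpan v i, rfl⟩
    rw [Submodule.map_coe]
    refine T.isometry.isClosedEmbedding.isClosedMap _ ?_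
    rw [← h.2]
    exact Submodule.isClosed_topologicalClosure _
  · rw [← h.2]
    refine (Submodule.topologicalClosure_map T.toContinuousLinearMap _).trans ?_
    refine Submodule.topologicalClosure_mono ?_
    rw [Submodule.map_span, Set.range_comp]
    rfl

/-! ### Shift invariant systems -/

/-- Translation by `γ` maps the system into itself. Inclusions between closed spans can therefore be
tested on generators alone. -/
lemma translate_mem_closedSpan {n : ℕ} {ι : Type*} {Γ : AddSubgroup (Rn n)} {F : ι → L2 n}
    {f : L2 n}
    (hf : f ∈ (Submodule.span ℂ (Set.range (shiftSystem Γ F))).topologicalClosure) (γ : Γ) :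
    translate γ f ∈ (Submodule.span ℂ (Set.range (shiftSystem Γ F))).topologicalClosure := by
  have hle := Submodule.topologicalClosure_map (translateIsometry (γ : Rn n)).toContinuousLinearMap
    (Submodule.span ℂ (Set.range (shiftSystem Γ F)))
  have hsub : Submodule.map (translateIsometry (γ : Rn n)).toContinuousLinearMap.toLinearMap
      (Submodule.span ℂ (Set.range (shiftSystem Γ F)))
      ≤ Submodule.span ℂ (Set.range (shiftSystem Γ F)) := by
    rw [Submodule.map_span, Submodule.span_le]
    rintro _ ⟨_, ⟨x, rfl⟩, rfl⟩
    refine Submodule.subset_span ⟨(x.1, γ + x.2), ?_⟩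
    exact (translate_translate (γ : Rn n) x.2 (F x.1)).symm
  exact Submodule.topologicalClosure_mono hsub (hle ⟨f, hf, rfl⟩)

lemma norm_inner_translate {n : ℕ} (y : Rn n) (f g : L2 n) :
    ‖inner ℂ (translate y g) f‖ = ‖inner ℂ (translate (-y) f) g‖ := by
  rw [norm_inner_symm]
  congr 1
  conv_rhs => rw [← translate_zero g]
  rw [inner_translate_translate, zero_sub, neg_neg]

lemma sum_tsum_norm_inner_sq {n : ℕ} {ι : Type*} [Fintype ι] {Γ : AddSubgroup (Rn n)}
    {F : ι → L2 n} (hF : Orthonormal ℂ (shiftSystem Γ F)) (f : L2 n) :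
    ∑ i, ∑' γ : Γ, ‖inner ℂ (translate γ (F i)) f‖ ^ 2
      = ‖(Submodule.span ℂ (Set.range (shiftSystem Γ F))).topologicalClosure.starProjection f‖ ^ 2
      := by
  have h := hasSum_norm_inner_sq hF f
  rw [← h.tsum_eq, h.summable.tsum_prod, tsum_fintype]
  rfl

lemma norm_generator {n : ℕ} {ι : Type*} {Γ : AddSubgroup (Rn n)}
    {F : ι → L2 n} (hF : Orthonormal ℂ (shiftSystem Γ F)) (i : ι) : ‖F i‖ = 1 := by
  rw [← hF.1 (i, 0)]
  exact (norm_translate _ _).symm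

/-- An orthonormal shift invariant system contained in the closed span of a second one spans it if
and only if both have the same number of generators. -/
lemma generators_mem_closedSpan_iff {n : ℕ} {ι κ : Type*} [Fintype ι] [Fintype κ]
    {Γ : AddSubgroup (Rn n)} {F : ι → L2 n} {G : κ → L2 n}
    (hF : Orthonormal ℂ (shiftSystem Γ F)) (hG : Orthonormal ℂ (shiftSystem Γ G))
    (hFG : ∀ i, F i ∈ (Submodule.span ℂ (Set.range (shiftSystem Γ G))).topologicalClosure) :
    (∀ x, G x ∈ (Submodule.span ℂ (Set.range (shiftSystem Γ F))).topologicalClosure) ↔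
      Fintype.card ι = Fintype.card κ := by
  set S := (Submodule.span ℂ (Set.range (shiftSystem Γ F))).topologicalClosure with hS
  -- Double counting: with the shift moved to the other factor and `γ` replaced by `-γ`, the sum for
  -- fixed `i` becomes the squared norm of the projection of `F i` to the span of the `G`-system.
  -- This is `1`, because `F i` lies there.
  have hsum : ∑ x, ‖S.starProjection (G x)‖ ^ 2 = Fintype.card ι := by
    have h1 : ∀ i, ∑ x, ∑' γ : Γ, ‖inner ℂ (translate γ (F i)) (G x)‖ ^ 2 = 1 := by
      intro i
      have h2 := sum_tsum_norm_inner_sq hG (F i)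
      rw [Submodule.starProjection_eq_self_iff.2 (hFG i), norm_generator hF, one_pow] at h2
      rw [← h2]
      refine Finset.sum_congr rfl fun x _ => ?_
      rw [← (Equiv.neg Γ).tsum_eq]
      refine tsum_congr fun γ => ?_
      rw [norm_inner_translate (γ : Rn n)]
      rfl
    simp only [hS, ← sum_tsum_norm_inner_sq hF]
    rw [Finset.sum_comm]
    simp [h1]
  have hle : ∀ x ∈ Finset.univ, ‖S.starProjection (G x)‖ ^ 2 ≤ (1 : ℝ) := fun x _ => by
    have := S.norm_starProjection_apply_le (G x)
    rw [norm_generator hG] at this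
    exact pow_le_one₀ (norm_nonneg _) this
  have hmem : ∀ x, G x ∈ S ↔ ‖S.starProjection (G x)‖ ^ 2 = 1 := fun x => by
    rw [Submodule.mem_iff_norm_starProjection, norm_generator hG,
      pow_eq_one_iff_of_nonneg (norm_nonneg _) two_ne_zero]
  -- Each term is at most `1`, so the total reaches the number of terms only if every term is `1`,
  -- that is, if every `G x` lies in `S`.
  have hcount := Finset.sum_eq_sum_iff_of_le hle
  rw [hsum] at hcount
  simp only [Finset.sum_const, Finset.card_univ, nsmul_eq_mul, mul_one, Nat.cast_inj,
    Finset.mem_univ, true_implies, ← hmem] at hcount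
  exact hcount.symm

/-! ### Regrouping shifts along cosets: bases of `V₀` and `V₁`. -/

lemma isTransversal_injective {n : ℕ} {ι : Type*} {d : ι → Rn n} {Γ Λ : AddSubgroup (Rn n)}
    (hd : IsTransversal d Γ Λ) {i j : ι} (h : d i - d j ∈ Λ) : i = j :=
  (hd.2 (d i) (hd.1 i)).unique (by rw [sub_self]; exact Λ.zero_mem) h

lemma isOrthonormalBasisOf_translates {n q : ℕ} {ι : Type*} {Γ Λ : AddSubgroup (Rn n)}
    (hΛ : Λ ≤ Γ) {k : Fin q → Rn n} (hk : IsTransversal k Γ Λ) {Φ : ι → L2 n}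
    {V : Submodule ℂ (L2 n)} (hΦ : IsOrthonormalBasisOf (shiftSystem Γ Φ) V) :
    IsOrthonormalBasisOf
      (shiftSystem Λ fun x : Fin q × ι => translate (k x.1) (Φ x.2)) V := by
  let e : (Fin q × ι) × Λ → ι × Γ := fun x =>
    (x.1.2, ⟨x.2 + k x.1.1, Γ.add_mem (hΛ x.2.2) (hk.1 _)⟩)
  have he : Function.Bijective e := by
    constructor
    · rintro ⟨⟨j, l⟩, m⟩ ⟨⟨j', l'⟩, m'⟩ h
      simp only [e, Prod.mk.injEq, Subtype.mk.injEq] at h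
      obtain ⟨rfl, h⟩ := h
      have hj : j = j' := by
        refine isTransversal_injective hk ?_
        have : k j - k j' = (m' : Rn n) - m := by
          rw [sub_eq_sub_iff_add_eq_add, add_comm, h, add_comm]
        rw [this]
        exact Λ.sub_mem m'.2 m.2
      subst hj
      rw [add_left_inj, SetLike.coe_eq_coe] at h
      rw [h]
    · rintro ⟨l, γ⟩
      obtain ⟨j, hj, -⟩ := hk.2 γ γ.2
      exact ⟨((j, l), ⟨_, hj⟩), by simp [e]⟩
  convert hΦ.comp_bijective he using 1
  funext x
  simp [shiftSystem, e, translate_translate]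

/-- Shifting the generator by `m` gives `D_A T_{Am - d_j} φ^l`, and every element of `Γ` is uniquely
`Am - d_j`. The sign of `d_j` is chosen so that `T_{-d_j}` becomes the factor `e^{2 π i ⟨d_j, ξ⟩}`
of the polyphase decomposition. -/
lemma isOrthonormalBasisOf_dilates {n p : ℕ} {ι : Type*} (A : GL (Fin n) ℝ)
    {Γ : AddSubgroup (Rn n)} (hA : imageLattice (A : Matrix (Fin n) (Fin n) ℝ) ≤ Γ)
    {d : Fin p → Rn n}
    (hd : IsTransversal d Γ (imageLattice (A : Matrix (Fin n) (Fin n) ℝ))) {Φ : ι → L2 n}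
    {V : Submodule ℂ (L2 n)} (hΦ : IsOrthonormalBasisOf (shiftSystem Γ Φ) V) :
    IsOrthonormalBasisOf (shiftSystem (intLattice n)
      fun x : Fin p × ι => dilate A (translate (-d x.1) (Φ x.2))) (V.map (dilate A)) := by
  have himg : ∀ m : intLattice n, act (A : Matrix (Fin n) (Fin n) ℝ) (m : Rn n) ∈
      imageLattice (A : Matrix (Fin n) (Fin n) ℝ) := fun m => ⟨m, m.2, rfl⟩
  let e : (Fin p × ι) × intLattice n → ι × Γ := fun x =>
    (x.1.2, ⟨act A.1 x.2 - d x.1.1, Γ.sub_mem (hA (himg x.2)) (hd.1 _)⟩)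
  have he : Function.Bijective e := by
    constructor
    · rintro ⟨⟨j, l⟩, m⟩ ⟨⟨j', l'⟩, m'⟩ h
      simp only [e, Prod.mk.injEq, Subtype.mk.injEq] at h
      obtain ⟨rfl, h⟩ := h
      have hj : j = j' := by
        refine isTransversal_injective hd ?_
        have : d j - d j' = act A.1 (m : Rn n) - act A.1 (m' : Rn n) := by
          rw [sub_eq_sub_iff_add_eq_add] at h ⊢
          rw [h]
          abel
        rw [this]
        exact AddSubgroup.sub_mem _ (himg m) (himg m')
      subst hj
      rw [sub_left_inj] at h
      have h' := congrArg (act ((A⁻¹ : GL (Fin n) ℝ) : Matrix (Fin n) (Fin n) ℝ)) h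
      rw [act_inv_act, act_inv_act, SetLike.coe_eq_coe] at h'
      rw [h']
    · rintro ⟨l, γ⟩
      -- The generators carry `-d_j`, so the transversal is applied to `-γ`: from `Am = -γ - d_j`
      -- follows `γ = A(-m) - d_j`.
      obtain ⟨j, ⟨m, hm, hmj⟩, -⟩ := hd.2 (-γ) (Γ.neg_mem γ.2)
      refine ⟨((j, l), -⟨m, hm⟩), ?_⟩
      have hmj' : act A.1 m = -γ - d j := hmj
      simp [e, map_neg, hmj']
  convert (hΦ.comp_bijective he).map_isometry (dilateIsometry A) using 1
  swap
  · rfl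
  funext x
  change translate x.2 (dilate A (translate (-d x.1.1) (Φ x.1.2)))
    = dilate A (translate (act A.1 x.2 - d x.1.1) (Φ x.1.2))
  rw [translate_dilate, translate_translate, sub_eq_add_neg]

/-! ### Orthonormality in terms of polyphase components -/

lemma orthonormal_shiftSystem_iff {n : ℕ} {ι : Type*} [DecidableEq ι] {Γ : AddSubgroup (Rn n)}
    {F : ι → L2 n} : Orthonormal ℂ (shiftSystem Γ F) ↔
      ∀ i j, ∀ m : Γ, inner ℂ (F i) (translate (-(m : Rn n)) (F j))
        = if m = 0 then (if i = j then 1 else 0) else 0 := by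
  classical
  rw [orthonormal_iff_ite]
  constructor
  · intro h i j m
    have h1 := h (i, 0) (j, -m)
    simp only [shiftSystem, AddSubgroup.coe_zero, translate_zero, AddSubgroup.coe_neg,
      Prod.mk.injEq, zero_eq_neg] at h1
    rw [h1]
    by_cases hm : m = 0 <;> by_cases hij : i = j <;> simp [hm, hij]
  · rintro h ⟨i, a⟩ ⟨j, b⟩
    have h1 := h i j (a - b)
    simp only [shiftSystem, inner_translate_translate]
    rw [AddSubgroup.coe_sub, neg_sub] at h1
    rw [h1]
    by_cases hm : a = b <;> by_cases hij : i = j <;> simp [hm, hij, sub_eq_zero]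

lemma orthonormal_shiftSystem_iff_integral {n : ℕ} {ι : Type*} [DecidableEq ι]
    {Γ : AddSubgroup (Rn n)} {F : ι → L2 n} : Orthonormal ℂ (shiftSystem Γ F) ↔
      ∀ i j, ∀ m : Γ, ∫ ξ, character (m : Rn n) ξ
        * ((starRingEnd ℂ) ((𝓕 (F i) : L2 n) ξ) * (𝓕 (F j) : L2 n) ξ)
        = if m = 0 then (if i = j then 1 else 0) else 0 := by
  rw [orthonormal_shiftSystem_iff]
  simp only [inner_translate_eq_integral, neg_neg]

/-- The transpose of an invertible matrix, as an invertible matrix. -/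
def transposeGL {n : ℕ} (A : GL (Fin n) ℝ) : GL (Fin n) ℝ where
  val := (A : Matrix (Fin n) (Fin n) ℝ)ᵀ
  inv := ((A⁻¹ : GL (Fin n) ℝ) : Matrix (Fin n) (Fin n) ℝ)ᵀ
  val_inv := by rw [← Matrix.transpose_mul, ← Units.val_mul, inv_mul_cancel]; simp
  inv_val := by rw [← Matrix.transpose_mul, ← Units.val_mul, mul_inv_cancel]; simp

lemma inner_act_transposeGL_inv {n : ℕ} (A : GL (Fin n) ℝ) (x y : Rn n) :
    inner ℝ (act (((transposeGL A)⁻¹ : GL (Fin n) ℝ) : Matrix (Fin n) (Fin n) ℝ) x)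
      (act (A : Matrix (Fin n) (Fin n) ℝ) y) = inner ℝ x y := by
  rw [← inner_act_transpose]
  exact congrArg (fun z => inner ℝ z y) (act_act_inv (transposeGL A) x)

/-- Makes `Q (B⁻¹ η)` periodic in `η` under `ℤⁿ` when `Q` is periodic under the dual of `A ℤⁿ`. -/
lemma act_transposeGL_inv_mem_dualLattice {n : ℕ} (A : GL (Fin n) ℝ) (k : intLattice n) :
    act (((transposeGL A)⁻¹ : GL (Fin n) ℝ) : Matrix (Fin n) (Fin n) ℝ) k ∈
      dualLattice (imageLattice (A : Matrix (Fin n) (Fin n) ℝ)) := by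
  rintro _ ⟨m, hm, rfl⟩
  obtain ⟨z, hz⟩ := exists_int_inner_intLattice k ⟨m, hm⟩
  exact ⟨z, (inner_act_transposeGL_inv A k m).trans hz⟩

lemma modulate_dilate {n : ℕ} (A : GL (Fin n) ℝ) (y : Rn n) (f : L2 n) :
    modulate y (dilate (transposeGL A)⁻¹ f)
      = dilate (transposeGL A)⁻¹ (modulate (act (A : Matrix (Fin n) (Fin n) ℝ) y) f) := by
  apply Lp.ext
  filter_upwards [coeFn_modulate y (dilate (transposeGL A)⁻¹ f),
    coeFn_dilate (transposeGL A)⁻¹ (modulate (act A.1 y) f),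
    coeFn_dilate (transposeGL A)⁻¹ f,
    (quasiMeasurePreserving_act (transposeGL A)⁻¹).ae (coeFn_modulate (act A.1 y) f)]
    with x h1 h2 h3 h4
  have h5 : character (act A.1 y) (act (transposeGL A)⁻¹.1 x) = character y x := by
    rw [character, character, real_inner_comm, inner_act_transposeGL_inv, real_inner_comm]
  rw [h1, h2, h3, h4, h5]
  ring

lemma modulate_modulate {n : ℕ} (y z : Rn n) (f : L2 n) :
    modulate y (modulate z f) = modulate (y + z) f := by
  apply Lp.ext
  filter_upwards [coeFn_modulate y (modulate z f), coeFn_modulate z f, coeFn_modulate (y + z) f]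
    with x h1 h2 h3
  rw [h1, h2, h3, character_add_left, mul_assoc]

lemma inner_modulate_fourier {n : ℕ} (y z : Rn n) (f g : L2 n) :
    inner ℂ (modulate y (𝓕 f)) (modulate z (𝓕 g))
      = inner ℂ (translate (-y) f) (translate (-z) g) := by
  rw [← Lp.inner_fourier_eq (translate (-y) f), fourier_translate, fourier_translate, neg_neg,
    neg_neg]

lemma integral_character_mul_eq_inner {n : ℕ} (m : Rn n) (f g : L2 n) :
    ∫ ξ, character m ξ * ((starRingEnd ℂ) (f ξ) * g ξ) = inner ℂ f (modulate m g) := by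
  rw [L2.inner_def]
  refine integral_congr_ae ?_
  filter_upwards [coeFn_modulate m g] with ξ hξ
  rw [hξ, RCLike.inner_apply]
  ring

/-- The polyphase components are the coefficients of the Fourier transforms of the `F i` with
respect to the dilates of the functions `e^{2 π i ⟨dⱼ, ·⟩} Φ^`. -/
lemma ae_fourier_eq_sum_polyphase {n N p : ℕ} {ι : Type*} {A : GL (Fin n) ℝ} {Φ : Fin N → L2 n}
    {F : ι → L2 n} {R : Rn n → Matrix ι (Fin N) ℂ} (hR : IsFilter A Φ F R)
    {Λ : AddSubgroup (Rn n)} {d : Fin p → Rn n} {Q : Fin p → Rn n → Matrix ι (Fin N) ℂ}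
    (hQ : IsPolyphase Λ d R Q) (i : ι) :
    ∀ᵐ η : Rn n, (𝓕 (F i) : L2 n) η = ∑ x : Fin p × Fin N,
      blockRow (fun j => Q j (act (transposeGL A)⁻¹.1 η)) i x
        * dilate (transposeGL A)⁻¹ (modulate (d x.1) (𝓕 (Φ x.2))) η := by
  have h1 : ∀ᵐ η : Rn n, ∀ x : Fin p × Fin N,
      dilate (transposeGL A)⁻¹ (modulate (d x.1) (𝓕 (Φ x.2))) η
        = (Real.sqrt |(transposeGL A)⁻¹.1.det| : ℂ) * (character (d x.1)
          (act (transposeGL A)⁻¹.1 η) * (𝓕 (Φ x.2) : L2 n) (act (transposeGL A)⁻¹.1 η)) := by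
    rw [ae_all_iff]
    intro x
    filter_upwards [coeFn_dilate (transposeGL A)⁻¹ (modulate (d x.1) (𝓕 (Φ x.2))),
      (quasiMeasurePreserving_act (transposeGL A)⁻¹).ae (coeFn_modulate (d x.1) (𝓕 (Φ x.2)))]
      with η h2 h3
    rw [h2, h3]
  -- The normalization of the dilation by `B⁻¹` cancels the factor `b^{1/2}` of the filter equation,
  -- which is used at `ξ = B⁻¹ η`.
  have hdet : (Real.sqrt |(transposeGL A)⁻¹.1.det| : ℂ) * (Real.sqrt |A.1.det| : ℂ) = 1 := by
    rw [← Complex.ofReal_mul, ← Real.sqrt_mul (abs_nonneg _), ← abs_mul]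
    have : (transposeGL A)⁻¹.1.det * A.1.det = 1 := by
      rw [← Matrix.det_transpose A.1]
      change (transposeGL A)⁻¹.1.det * (transposeGL A).1.det = 1
      rw [← Matrix.det_mul, ← Units.val_mul, inv_mul_cancel, Units.val_one, Matrix.det_one]
    rw [this]
    simp
  filter_upwards [h1, (quasiMeasurePreserving_act (transposeGL A)⁻¹).ae hR.2.2,
    (quasiMeasurePreserving_act (transposeGL A)⁻¹).ae hQ.2.2] with η h2 h3 h4
  have h5 := congrFun h3 i
  have h6 : act A.1ᵀ (act (transposeGL A)⁻¹.1 η) = η := act_act_inv (transposeGL A) η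
  simp only [h6] at h5
  rw [← one_mul ((𝓕 (F i) : L2 n) η), ← hdet, mul_assoc, h5, h4]
  simp only [h2, blockRow, Matrix.of_apply, Fintype.sum_prod_type, Matrix.mulVec, dotProduct,
    Matrix.sum_apply, Matrix.smul_apply, smul_eq_mul, Finset.mul_sum, Finset.sum_mul, character]
  rw [Finset.sum_comm]
  refine Finset.sum_congr rfl fun j _ => Finset.sum_congr rfl fun l _ => ?_
  ring

/-- `modulations_orthonormal_iff` in the variable `η = B ξ`, with the polyphase block matrix as
coefficient matrix. -/
lemma orthonormal_shiftSystem_iff_polyphase {n N p : ℕ} {ι κ : Type*} [Fintype ι] [Fintype κ]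
    [DecidableEq ι] [DecidableEq κ] {A : GL (Fin n) ℝ} {Φ : Fin N → L2 n} {d : Fin p → Rn n}
    (hg : Orthonormal ℂ (shiftSystem (intLattice n)
      fun x : Fin p × Fin N => dilate A (translate (-d x.1) (Φ x.2))))
    {F : ι → L2 n} {R : Rn n → Matrix ι (Fin N) ℂ} (hR : IsFilter A Φ F R)
    {Q : Fin p → Rn n → Matrix ι (Fin N) ℂ}
    (hQ : IsPolyphase (imageLattice (A : Matrix (Fin n) (Fin n) ℝ)) d R Q)
    {F' : κ → L2 n} {R' : Rn n → Matrix κ (Fin N) ℂ} (hR' : IsFilter A Φ F' R')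
    {Q' : Fin p → Rn n → Matrix κ (Fin N) ℂ}
    (hQ' : IsPolyphase (imageLattice (A : Matrix (Fin n) (Fin n) ℝ)) d R' Q') :
    Orthonormal ℂ (shiftSystem (intLattice n) (Sum.elim F F')) ↔
      ∀ᵐ ξ : Rn n, blockRow (fun j => Matrix.fromRows (Q j ξ) (Q' j ξ))
        * (blockRow fun j => Matrix.fromRows (Q j ξ) (Q' j ξ))ᴴ = 1 := by
  rw [orthonormal_shiftSystem_iff_integral, ← ae_comp_act_iff (transposeGL A)⁻¹]
  refine modulations_orthonormal_iff (G := fun x : Fin p × Fin N =>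
    (dilate (transposeGL A)⁻¹ (modulate (d x.1) (𝓕 (Φ x.2))) : Rn n → ℂ))
    (fun x => Lp.memLp _) ?_ (fun i => Lp.memLp _)
    (C := fun η => blockRow fun j => Matrix.fromRows (Q j (act (transposeGL A)⁻¹.1 η))
      (Q' j (act (transposeGL A)⁻¹.1 η))) ?_ ?_
  · intro x y m
    -- Morally `G x` is the Fourier transform of `D_A T_{-d} Φ`, but only inner products matter: the
    -- dilation by `B⁻¹` is stripped off, Plancherel applied, and the dilation by `A` put back.
    rw [integral_character_mul_eq_inner, modulate_dilate, inner_dilate_dilate, modulate_modulate,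
      inner_modulate_fourier, ← inner_dilate_dilate A, neg_add, ← translate_translate, ← map_neg,
      ← translate_dilate]
    exact orthonormal_shiftSystem_iff.1 hg x y m
  · intro k ξ
    simp only [map_add, add_comm (act (transposeGL A)⁻¹.1 (k : Rn n)),
      hQ.2.1 _ _ (act_transposeGL_inv_mem_dualLattice A k),
      hQ'.2.1 _ _ (act_transposeGL_inv_mem_dualLattice A k)]
  · rintro (i | i)
    · exact ae_fourier_eq_sum_polyphase hR hQ i
    · exact ae_fourier_eq_sum_polyphase hR' hQ' i

lemma sum_mul_conjTranspose_eq_blockRow {N p : ℕ} {ι : Type*}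
    (Q : Fin p → Matrix ι (Fin N) ℂ) :
    ∑ j, Q j * (Q j)ᴴ = blockRow Q * (blockRow Q)ᴴ := by
  ext a b
  simp [Matrix.sum_apply, Matrix.mul_apply, blockRow, Fintype.sum_prod_type]

/-- The criterion of completing a basis, with its spanning clause replaced by the count of
generators. -/
lemma isOrthonormalBasisOf_complement_iff {n : ℕ} {ι κ χ : Type*} [Fintype ι] [Fintype κ]
    [Fintype χ] {Γ : AddSubgroup (Rn n)} {V₀ V₁ : Submodule ℂ (L2 n)} {F : ι → L2 n}
    (hF : IsOrthonormalBasisOf (shiftSystem Γ F) V₀) {G : χ → L2 n}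
    (hG : IsOrthonormalBasisOf (shiftSystem Γ G) V₁) (hV : V₀ ≤ V₁) {Ψ : κ → L2 n}
    (hΨ : ∀ l, Ψ l ∈ V₁) :
    IsOrthonormalBasisOf (shiftSystem Γ Ψ) (V₁ ⊓ V₀ᗮ) ↔
      Fintype.card ι + Fintype.card κ = Fintype.card χ ∧
        Orthonormal ℂ (shiftSystem Γ (Sum.elim F Ψ)) := by
  have hcl : IsClosed (V₁ : Set (L2 n)) := hG.2 ▸ Submodule.isClosed_topologicalClosure _
  have hmem : ∀ i, F i ∈ V₁ := fun i => hV (by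
    have h := mem_closedSpan (shiftSystem Γ F) (i, 0)
    rw [hF.2] at h
    simpa [shiftSystem, translate_zero] using h)
  have htr : ∀ x, shiftSystem Γ Ψ x ∈ V₁ := fun x => by
    rw [← hG.2]
    exact translate_mem_closedSpan (by rw [hG.2]; exact hΨ x.1) x.2
  have heq : shiftSystem Γ (Sum.elim F Ψ)
      = Sum.elim (shiftSystem Γ F) (shiftSystem Γ Ψ) ∘ Equiv.sumProdDistrib ι κ Γ := by
    funext ⟨i, γ⟩
    cases i <;> rfl
  have ho : Orthonormal ℂ (Sum.elim (shiftSystem Γ F) (shiftSystem Γ Ψ)) ↔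
      Orthonormal ℂ (shiftSystem Γ (Sum.elim F Ψ)) := by
    rw [heq]
    refine ⟨fun h => h.comp _ (Equiv.injective _), fun h => ?_⟩
    have h1 := h.comp _ (Equiv.sumProdDistrib ι κ Γ).symm.injective
    rwa [Function.comp_assoc, Equiv.self_comp_symm, Function.comp_id] at h1
  have hr : Set.range (Sum.elim (shiftSystem Γ F) (shiftSystem Γ Ψ))
      = Set.range (shiftSystem Γ (Sum.elim F Ψ)) := by
    rw [heq, (Equiv.sumProdDistrib ι κ Γ).surjective.range_comp]
  rw [IsOrthonormalBasisOf, orthonormal_basis_complement_iff hF.1 hF.2 hV hcl htr, ho, hr,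
    and_comm]
  refine and_congr_left fun hon => ?_
  rw [← Fintype.card_sum, ← generators_mem_closedSpan_iff hon hG.1 (by
    rw [hG.2]
    rintro (i | i)
    exacts [hmem i, hΨ i]), ← hG.2]
  constructor
  · intro h x
    refine h ?_
    have h1 := mem_closedSpan (shiftSystem Γ G) (x, 0)
    simpa [shiftSystem, translate_zero] using h1
  · exact fun h => closedSpan_le (Submodule.isClosed_topologicalClosure _) fun x =>
      translate_mem_closedSpan (h x.1) x.2

end RationalDilation

theorem theorem4p5 {n N L p q : ℕ} (A : GL (Fin n) ℝ)
    (hrat : RationalDilation.HasRationalEntries (A : Matrix (Fin n) (Fin n) ℝ))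
    (hexp : RationalDilation.IsExpansive (A : Matrix (Fin n) (Fin n) ℝ))
    -- `p = |Γ / A ℤⁿ|` and `q = |Γ / ℤⁿ|` with `Γ = A ℤⁿ + ℤⁿ`
    (hp : p = (RationalDilation.imageLattice (A : Matrix (Fin n) (Fin n) ℝ)).relIndex
      (RationalDilation.sumLattice (A : Matrix (Fin n) (Fin n) ℝ)))
    (hq : q = (RationalDilation.intLattice n).relIndex
      (RationalDilation.sumLattice (A : Matrix (Fin n) (Fin n) ℝ)))
    (d : Fin p → RationalDilation.Rn n)
    (hd : RationalDilation.IsTransversal d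
      (RationalDilation.sumLattice (A : Matrix (Fin n) (Fin n) ℝ))
      (RationalDilation.imageLattice (A : Matrix (Fin n) (Fin n) ℝ)))
    (k : Fin q → RationalDilation.Rn n)
    (hk : RationalDilation.IsTransversal k
      (RationalDilation.sumLattice (A : Matrix (Fin n) (Fin n) ℝ))
      (RationalDilation.intLattice n))
    -- the refinable space `V₀` and `V₁ = D_A(V₀)`
    (V₀ V₁ : Submodule ℂ (RationalDilation.L2 n))
    (hV₁ : V₁ = V₀.map (RationalDilation.dilate A))
    (Φ : Fin N → RationalDilation.L2 n)
    (hΦ : RationalDilation.IsOrthonormalBasisOf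
      (RationalDilation.shiftSystem
        (RationalDilation.sumLattice (A : Matrix (Fin n) (Fin n) ℝ)) Φ) V₀)
    (href : V₀ ≤ V₁)
    (Ψ : Fin L → RationalDilation.L2 n) (hΨ : ∀ l, Ψ l ∈ V₁)
    -- the low-pass filter `M`, the high-pass filter `H`, and their polyphase components
    (M : RationalDilation.Rn n → Matrix (Fin q × Fin N) (Fin N) ℂ)
    (hM : RationalDilation.IsFilter A Φ
      (fun x : Fin q × Fin N => RationalDilation.translate (k x.1) (Φ x.2)) M)
    (H : RationalDilation.Rn n → Matrix (Fin L) (Fin N) ℂ)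
    (hH : RationalDilation.IsFilter A Φ Ψ H)
    (Mp : Fin p → RationalDilation.Rn n → Matrix (Fin q × Fin N) (Fin N) ℂ)
    (hMp : RationalDilation.IsPolyphase
      (RationalDilation.imageLattice (A : Matrix (Fin n) (Fin n) ℝ)) d M Mp)
    (Hp : Fin p → RationalDilation.Rn n → Matrix (Fin L) (Fin N) ℂ)
    (hHp : RationalDilation.IsPolyphase
      (RationalDilation.imageLattice (A : Matrix (Fin n) (Fin n) ℝ)) d H Hp) :
    (RationalDilation.IsOrthonormalBasisOf
        (RationalDilation.shiftSystem (RationalDilation.intLattice n) Ψ) (V₁ ⊓ V₀ᗮ) ↔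
      (L : ℤ) = (N : ℤ) * ((p : ℤ) - (q : ℤ)) ∧
        ∀ᵐ ξ : RationalDilation.Rn n,
          ∑ j, Matrix.fromRows (Mp j ξ) (Hp j ξ) * (Matrix.fromRows (Mp j ξ) (Hp j ξ))ᴴ = 1) ∧
    (RationalDilation.IsOrthonormalBasisOf
        (RationalDilation.shiftSystem (RationalDilation.intLattice n) Ψ) (V₁ ⊓ V₀ᗮ) ↔
      (L : ℤ) = (N : ℤ) * ((p : ℤ) - (q : ℤ)) ∧
        ∀ᵐ ξ : RationalDilation.Rn n,
          RationalDilation.IsUnitaryMatrix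
            (RationalDilation.blockRow fun j => Matrix.fromRows (Mp j ξ) (Hp j ξ))) := by
  have hF := RationalDilation.isOrthonormalBasisOf_translates le_sup_right hk hΦ
  have hG := RationalDilation.isOrthonormalBasisOf_dilates A le_sup_left hd hΦ
  rw [← hV₁] at hG
  have hmain := RationalDilation.isOrthonormalBasisOf_complement_iff hF hG href hΨ
  rw [RationalDilation.orthonormal_shiftSystem_iff_polyphase hG.1 hM hMp hH hHp] at hmain
  have hcard : Fintype.card (Fin q × Fin N) + Fintype.card (Fin L) = Fintype.card (Fin p × Fin N) ↔
      (L : ℤ) = (N : ℤ) * ((p : ℤ) - (q : ℤ)) := by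
    simp only [Fintype.card_prod, Fintype.card_fin]
    zify
    constructor <;> intro h <;> linarith
  refine ⟨?_, ?_⟩
  · simp only [RationalDilation.sum_mul_conjTranspose_eq_blockRow]
    rw [hmain, hcard]
  · rw [hmain, ← hcard]
    -- The dimension count makes the block matrix square, so a right inverse is also a left inverse.
    refine and_congr_right fun h => Filter.eventually_congr (.of_forall fun ξ => ?_)
    rw [← Fintype.card_sum] at h
    exact ⟨fun h1 => ⟨h1, (Matrix.mul_eq_one_comm_of_card_eq _ _ _ h).1 h1⟩, fun h1 => h1.1⟩
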